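/- Let $N\ge 2$ be even, let $s\in\{\tfrac12,1,\tfrac32,\dots\}$, and put $\eta_\alpha=e^{2\pi i\alpha/N}$ for $\alpha=1,\dots,N$. Let $a_\alpha^\dagger,b_\alpha^\dagger$ ($\alpha=1,\dots,N$) be bosonic creation operators with vacuum $|0\rangle$. The spin chain lives on the space of all vectors of their Fock space with exactly $2s$ bosons $a_\alpha^\dagger a_\alpha+b_\alpha^\dagger b_\alpha=2s$ at each site $\alpha$; the spin-$s$ operators $\mathbf S_\alpha$ of site $\alpha$ are given by $S^x_\alpha+iS^y_\alpha=a_\alpha^\dagger b_\alpha$, $S^x_\alpha-iS^y_\alpha=b_\alpha^\dagger a_\alpha$, $S^z_\alpha=\tfrac12(a_\alpha^\dagger a_\alpha-b_\alpha^\dagger b_\alpha)$, and $\mathbf S_{\rm tot}=\sum_\alpha\mathbf S_\alpha$. Let $$|\psi_0^S\rangle=\big(\Psi^{\rm HS}_0[a^\dagger,b^\dagger]\big)^{2s}|0\rangle,\qquad \Psi_0^{\rm HS}[a^\dagger,b^\dagger]=\sum_{A\subset\{1,\dots,N\},\,|A|=N/2}\ \prod_{\alpha<\beta;\ \alpha,\beta\in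 A}(\eta_\alpha-\eta_\beta)^2\prod_{\alpha\in A}\eta_\alpha\ \prod_{\alpha\in A}a_\alpha^\dagger\prod_{\alpha\notin A}b_\alpha^\dagger .$$ Write $\omega_{\alpha\beta\gamma}=\dfrac{1}{(\bar\eta_\alpha-\bar\eta_\beta)(\eta_\alpha-\eta_\gamma)}$, so that $\omega_{\alpha\beta\beta}=1/|\eta_\alpha-\eta_\beta|^2$, and $\mathbf S_\alpha\mathbf S_\beta$ for the scalar product; products of operators are taken in the order written. Define the vector operators $$\mathbf D_\alpha^S=\frac12\sum_{\beta\ne\alpha}\frac{\eta_\alpha+\eta_\beta}{\eta_\alpha-\eta_\beta}\Big[i(\mathbf S_\alpha\times\mathbf S_\beta)+(s+1)\mathbf S_\beta-\frac{1}{s+1}\mathbf S_\alpha(\mathbf S_\alpha\mathbf S_\beta)\Big],$$ $$\begin{aligned}\mathbf A_\alpha^S&=\sum_{\beta\ne\alpha}\frac{\mathbf S_\alpha(\mathbf S_\alpha\mathbf S_\beta)+(\mathbf S_\alpha\mathbf S_\beta)\mathbf S_\alpha+2(s+1)\mathbf S_\beta}{|\eta_\alpha-\eta_\beta|^2}\\&\quad+\sum_{\beta,\gamma\ne\alpha}\omega_{\alpha\beta\gamma}\Big[-\frac{(\mathbf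 S_\alpha\mathbf S_\beta)\mathbf S_\alpha(\mathbf S_\alpha\mathbf S_\gamma)+(\mathbf S_\alpha\mathbf S_\gamma)\mathbf S_\alpha(\mathbf S_\alpha\mathbf S_\beta)}{s+1}+2(s+2)\mathbf S_\alpha(\mathbf S_\beta\mathbf S_\gamma)-\mathbf S_\beta(\mathbf S_\alpha\mathbf S_\gamma)-(\mathbf S_\alpha\mathbf S_\beta)\mathbf S_\gamma\Big],\end{aligned}$$ where $\beta=\gamma$ is allowed in the double sum, $$\mathbf\Lambda^S=\frac12\sum_{\alpha\ne\beta}\frac{\eta_\alpha+\eta_\beta}{\eta_\alpha-\eta_\beta}\Big[i(\mathbf S_\alpha\times\mathbf S_\beta)-\frac{1}{s+1}\mathbf S_\alpha(\mathbf S_\alpha\mathbf S_\beta)\Big],$$ $$\begin{aligned}\mathbf\Upsilon^S&=-\frac1{s+1}\sum_{\alpha}\sum_{\beta,\gamma\ne\alpha}\omega_{\alpha\beta\gamma}\big[(\mathbf S_\alpha\mathbf S_\beta)\mathbf S_\alpha(\mathbf S_\alpha\mathbf S_\gamma)+(\mathbf S_\alpha\mathbf S_\gamma)\mathbf S_\alpha(\mathbf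 S_\alpha\mathbf S_\beta)\big]\\&\quad+\sum_{\alpha,\beta,\gamma\ \text{pairwise distinct}}\omega_{\alpha\beta\gamma}\big[2(s+2)\mathbf S_\alpha(\mathbf S_\beta\mathbf S_\gamma)-\mathbf S_\beta(\mathbf S_\alpha\mathbf S_\gamma)-(\mathbf S_\alpha\mathbf S_\beta)\mathbf S_\gamma\big],\end{aligned}$$ and the Hamiltonian and energy $$H^S=\frac{2\pi^2}{N^2}\Big[\sum_{\alpha\ne\beta}\frac{\mathbf S_\alpha\mathbf S_\beta}{|\eta_\alpha-\eta_\beta|^2}-\frac{1}{2(s+1)(2s+3)}\sum_{\alpha}\sum_{\beta,\gamma\ne\alpha}\omega_{\alpha\beta\gamma}\big[(\mathbf S_\alpha\mathbf S_\beta)(\mathbf S_\alpha\mathbf S_\gamma)+(\mathbf S_\alpha\mathbf S_\gamma)(\mathbf S_\alpha\mathbf S_\beta)\big]\Big],$$ $$E_0^S=-\frac{2\pi^2}{N^2}\,\frac{s(s+1)^2}{2s+3}\,\frac{N(N^2+5)}{12}.$$ Then: 1. All components of $\mathbf D_\alpha^S$ and of $\mathbf A_\alpha^S$ annihilate $|\psi_0^S\rangle$,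 for every $\alpha$. 2. $\sum_\alpha\mathbf D_\alpha^S=\mathbf\Lambda^S$, and $\mathbf\Lambda^S|\psi_0^S\rangle=0$. 3. $\sum_\alpha\mathbf A_\alpha^S=\mathbf\Upsilon^S+(s+1)^3\,\frac{N^2-1}{6}\,\mathbf S_{\rm tot}$, and $\mathbf\Upsilon^S|\psi_0^S\rangle=0$. 4. As operators on the spin chain, $$\frac{2\pi^2}{N^2}\Big[\frac{1}{2s(s+2)(2s+3)}\sum_\alpha\mathbf S_\alpha\mathbf A_\alpha^S+\frac{s+1}{2(2s+3)}\mathbf S_{\rm tot}^2\Big]=H^S-E_0^S .$$ -/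

import Mathlib

noncomputable section

namespace SpinChain

open MvPolynomial

/-! Schwinger boson Fock space of `N` sites with modes `a_α` (index `(α, true)`) and `b_α`
(index `(α, false)`). A vector is written as the polynomial in the creation operators that produces
it from the vacuum `|0⟩ = 1`; creation is multiplication by a variable, annihilation is the
partial derivative. -/

/-- Finite-particle Fock space of the Schwinger bosons on `N` sites. -/
abbrev Fock (N : ℕ) : Type := MvPolynomial (Fin N × Bool) ℂ

/-- Creation operator of the mode `j`. -/
def create {N : ℕ} (j : Fin N × Bool) : Module.End ℂ (Fock N) :=
  LinearMap.mulLeft ℂ (X j : Fock N)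

/-- Annihilation operator of the mode `j`. -/
def annihilate {N : ℕ} (j : Fin N × Bool) : Module.End ℂ (Fock N) :=
  (pderiv j).toLinearMap

/-- Number of bosons at the site `α`: `a†a + b†b`. -/
def bosonNumber {N : ℕ} (α : Fin N) : Module.End ℂ (Fock N) :=
  create (α, true) * annihilate (α, true) + create (α, false) * annihilate (α, false)

/-- `S = ½ (a†, b†) σ (a, b)ᵀ` at the site `α`; the components `0, 1, 2` are `x, y, z`. -/
def fockSpin {N : ℕ} (α : Fin N) : Fin 3 → Module.End ℂ (Fock N) :=
  ![(1 / 2 : ℂ) • (create (α, true) * annihilate (α, false)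
      + create (α, false) * annihilate (α, true)),
    (-Complex.I / 2) • (create (α, true) * annihilate (α, false)
      - create (α, false) * annihilate (α, true)),
    (1 / 2 : ℂ) • (create (α, true) * annihilate (α, true)
      - create (α, false) * annihilate (α, false))]

/-- State space of the spin chain with spin `s = k / 2` on each of the `N` sites: the vectors
with exactly `k = 2s` bosons on every site. -/
def SpinSpace (N k : ℕ) : Submodule ℂ (Fock N) :=
  ⨅ α : Fin N, Module.End.eigenspace (bosonNumber α) (k : ℂ)

theorem mem_spinSpace {N k : ℕ} {p : Fock N} :
    p ∈ SpinSpace N k ↔ ∀ α, bosonNumber α p = (k : ℂ) • p := by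
  simp [SpinSpace, Submodule.mem_iInf]

theorem bosonNumber_apply {N : ℕ} (α : Fin N) (p : Fock N) :
    bosonNumber α p
      = X (α, true) * pderiv (α, true) p + X (α, false) * pderiv (α, false) p := rfl

theorem pderiv_comm' {N : ℕ} (i j : Fin N × Bool) (p : Fock N) :
    pderiv i (pderiv j p) = pderiv j (pderiv i p) := by
  have h : ⁅(pderiv i : Derivation ℂ (Fock N) (Fock N)),
      (pderiv j : Derivation ℂ (Fock N) (Fock N))⁆ = 0 := by
    apply MvPolynomial.derivation_ext
    intro l
    rw [Derivation.commutator_apply]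
    simp only [pderiv_X, Pi.single_apply]
    split_ifs <;> simp
  have := congrArg (fun d : Derivation ℂ (Fock N) (Fock N) => d p) h
  simp only [Derivation.commutator_apply] at this
  exact sub_eq_zero.mp this

theorem bosonNumber_hop {N : ℕ} (α β : Fin N) (c d : Bool) :
    Commute (bosonNumber α) (create (β, c) * annihilate (β, d)) := by
  apply LinearMap.ext
  intro p
  change X (α, true) * pderiv (α, true) (X (β, c) * pderiv (β, d) p)
      + X (α, false) * pderiv (α, false) (X (β, c) * pderiv (β, d) p)
    = X (β, c) * pderiv (β, d) (X (α, true) * pderiv (α, true) p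
        + X (α, false) * pderiv (α, false) p)
  simp only [map_add, Derivation.leibniz, smul_eq_mul, pderiv_X, Pi.single_apply,
    pderiv_comm' (β, d) (α, true), pderiv_comm' (β, d) (α, false), Prod.mk.injEq]
  by_cases h : α = β
  · subst h
    cases c <;> cases d <;> simp <;> ring
  · simp [h, Ne.symm h]
    ring

theorem bosonNumber_fockSpin {N : ℕ} (α β : Fin N) (i : Fin 3) :
    Commute (bosonNumber α) (fockSpin β i) := by
  fin_cases i
  · exact ((bosonNumber_hop α β _ _).add_right (bosonNumber_hop α β _ _)).smul_right _
  · exact ((bosonNumber_hop α β _ _).sub_right (bosonNumber_hop α β _ _)).smul_right _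
  · exact ((bosonNumber_hop α β _ _).sub_right (bosonNumber_hop α β _ _)).smul_right _

theorem fockSpin_mem {N k : ℕ} (α : Fin N) (i : Fin 3) :
    ∀ p ∈ SpinSpace N k, fockSpin α i p ∈ SpinSpace N k := by
  intro p hp
  rw [mem_spinSpace] at hp ⊢
  intro β
  have h := LinearMap.congr_fun (bosonNumber_fockSpin β α i).eq p
  simp only [Module.End.mul_apply] at h
  rw [h, hp β, map_smul]

/-- Component `i` of the spin operator of the site `α`, acting on the spin chain. -/
def spin {N k : ℕ} (α : Fin N) (i : Fin 3) : Module.End ℂ (SpinSpace N k) :=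
  (fockSpin α i).restrict (fockSpin_mem α i)

/-- Coordinates `η_α = exp (2πi α / N)`, where the sites `0, …, N - 1` of `Fin N` stand for
`α = 1, …, N`. -/
def eta {N : ℕ} (α : Fin N) : ℂ :=
  Complex.exp (2 * (Real.pi : ℂ) * Complex.I * ((α : ℕ) + 1 : ℂ) / (N : ℂ))

/-- Haldane–Shastry wave function `∏_{i<j} (z_i - z_j)² ∏_i z_i` of the configuration with up
spins on the sites in `A`. -/
def hsWave {N : ℕ} (A : Finset (Fin N)) : ℂ :=
  (∏ i ∈ A, ∏ j ∈ A with i < j, (eta i - eta j) ^ 2) * ∏ i ∈ A, eta i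

/-- `Ψ^HS[a†, b†]`: the sum over the configurations of `N / 2` up spins on the chain. -/
def hsPoly (N : ℕ) : Fock N :=
  ∑ A ∈ (Finset.univ : Finset (Fin N)).powersetCard (N / 2),
    hsWave A • ((∏ α ∈ A, X (α, true)) * ∏ α ∈ Aᶜ, X (α, false))

theorem bosonNumber_mul {N : ℕ} (α : Fin N) (p q : Fock N) :
    bosonNumber α (p * q) = bosonNumber α p * q + p * bosonNumber α q := by
  simp only [bosonNumber_apply, Derivation.leibniz, smul_eq_mul]
  ring

theorem bosonNumber_X {N : ℕ} (α β : Fin N) (c : Bool) :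
    bosonNumber α (X (β, c) : Fock N) = if α = β then X (β, c) else 0 := by
  simp only [bosonNumber_apply, pderiv_X, Pi.single_apply, Prod.mk.injEq]
  by_cases h : α = β
  · subst h
    cases c <;> simp
  · simp [h, Ne.symm h]

theorem bosonNumber_prod {N : ℕ} (α : Fin N) (c : Bool) (A : Finset (Fin N)) :
    bosonNumber α (∏ β ∈ A, X (β, c) : Fock N) =
      if α ∈ A then ∏ β ∈ A, X (β, c) else 0 := by
  induction A using Finset.induction_on with
  | empty => simp [bosonNumber_apply]
  | insert β A hβ ih =>
    rw [Finset.prod_insert hβ, bosonNumber_mul, ih, bosonNumber_X]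
    by_cases h : α = β
    · subst h
      simp [hβ]
    · simp [h]

theorem hsPoly_mem {N : ℕ} : hsPoly N ∈ SpinSpace N 1 := by
  rw [mem_spinSpace]
  intro α
  rw [hsPoly, map_sum, Nat.cast_one, one_smul]
  refine Finset.sum_congr rfl fun A _ => ?_
  rw [map_smul, bosonNumber_mul, bosonNumber_prod, bosonNumber_prod]
  by_cases h : α ∈ A <;> simp [h]

theorem hsPoly_pow_mem {N : ℕ} (k : ℕ) : hsPoly N ^ k ∈ SpinSpace N k := by
  rw [mem_spinSpace]
  intro α
  have h1 : bosonNumber α (hsPoly N) = hsPoly N := by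
    simpa using mem_spinSpace.mp hsPoly_mem α
  induction k with
  | zero => simp [bosonNumber_apply]
  | succ k ih =>
    rw [pow_succ, bosonNumber_mul, ih, h1, Nat.cast_succ, add_smul, one_smul, smul_mul_assoc]

/-- The spin liquid state `|ψ^S_0⟩ = (Ψ^HS[a†, b†])^(2s) |0⟩` with `2s = k`. -/
def groundState (N k : ℕ) : SpinSpace N k :=
  ⟨hsPoly N ^ k, hsPoly_pow_mem k⟩

/-! Scalar and vector products of vector operators, with the order of the factors kept. -/

/-- `A · B = ∑ i, A i * B i`. -/
def dot {R : Type*} [Ring R] (A B : Fin 3 → R) : R := ∑ i, A i * B i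

/-- `(A × B) i = ε_{ijk} A j * B k`. -/
def cross {R : Type*} [Ring R] (A B : Fin 3 → R) : Fin 3 → R :=
  fun i => A (i + 1) * B (i + 2) - A (i + 2) * B (i + 1)

/-- The spin quantum number `s = k / 2`. -/
def qn (k : ℕ) : ℂ := (k : ℂ) / 2

/-- `ω_{αβγ} = 1 / ((conj η_α - conj η_β) (η_α - η_γ))`. -/
def omega {N : ℕ} (α β γ : Fin N) : ℂ :=
  1 / ((starRingEnd ℂ (eta α) - starRingEnd ℂ (eta β)) * (eta α - eta γ))

/-- `1 / |η_α - η_β|²`. -/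
def invDistSq {N : ℕ} (α β : Fin N) : ℂ := ((1 / ‖eta α - eta β‖ ^ 2 : ℝ) : ℂ)

/-- Scalar product `S_α · S_β`. -/
def spinDot {N k : ℕ} (α β : Fin N) : Module.End ℂ (SpinSpace N k) :=
  dot (spin α) (spin β)

/-- Total spin. -/
def totalSpin {N k : ℕ} (i : Fin 3) : Module.End ℂ (SpinSpace N k) :=
  ∑ α : Fin N, spin α i

/-- The vector operator `D_α^S`. -/
def opD {N k : ℕ} (α : Fin N) (i : Fin 3) : Module.End ℂ (SpinSpace N k) :=
  (1 / 2 : ℂ) • ∑ β ∈ Finset.univ.erase α, ((eta α + eta β) / (eta α - eta β)) •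
    (Complex.I • cross (spin α) (spin β) i + (qn k + 1) • spin β i
      - (1 / (qn k + 1)) • (spin α i * spinDot α β))

/-- The vector operator `Λ^S`. -/
def opLambda {N k : ℕ} (i : Fin 3) : Module.End ℂ (SpinSpace N k) :=
  (1 / 2 : ℂ) • ∑ α : Fin N, ∑ β ∈ Finset.univ.erase α,
    ((eta α + eta β) / (eta α - eta β)) •
      (Complex.I • cross (spin α) (spin β) i - (1 / (qn k + 1)) • (spin α i * spinDot α β))

/-- `(S_α·S_β) S_α (S_α·S_γ) + (S_α·S_γ) S_α (S_α·S_β)`. -/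
def fiveSpin {N k : ℕ} (α β γ : Fin N) (i : Fin 3) : Module.End ℂ (SpinSpace N k) :=
  spinDot α β * spin α i * spinDot α γ + spinDot α γ * spin α i * spinDot α β

/-- `2(s+2) S_α (S_β·S_γ) - S_β (S_α·S_γ) - (S_α·S_β) S_γ`. -/
def threeSpin {N k : ℕ} (α β γ : Fin N) (i : Fin 3) : Module.End ℂ (SpinSpace N k) :=
  (2 * (qn k + 2)) • (spin α i * spinDot β γ) - spin β i * spinDot α γ
    - spinDot α β * spin γ i

/-- The vector operator `A_α^S`; in the double sum `β = γ` is allowed. -/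
def opA {N k : ℕ} (α : Fin N) (i : Fin 3) : Module.End ℂ (SpinSpace N k) :=
  (∑ β ∈ Finset.univ.erase α, invDistSq α β •
    (spin α i * spinDot α β + spinDot α β * spin α i + (2 * (qn k + 1)) • spin β i))
  + ∑ β ∈ Finset.univ.erase α, ∑ γ ∈ Finset.univ.erase α, omega α β γ •
      (-((1 / (qn k + 1)) • fiveSpin α β γ i) + threeSpin α β γ i)

/-- The vector operator `Υ^S`: `β = γ` is allowed in the first sum, while `α, β, γ` are
pairwise distinct in the second one. -/
def opUpsilon {N k : ℕ} (i : Fin 3) : Module.End ℂ (SpinSpace N k) :=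
  -((1 / (qn k + 1)) • ∑ α : Fin N, ∑ β ∈ Finset.univ.erase α, ∑ γ ∈ Finset.univ.erase α,
      omega α β γ • fiveSpin α β γ i)
  + ∑ α : Fin N, ∑ β ∈ Finset.univ.erase α, ∑ γ ∈ (Finset.univ.erase α).erase β,
      omega α β γ • threeSpin α β γ i

/-- The Hamiltonian `H^S`; in the triple sum `β = γ` is allowed. -/
def hamiltonian (N k : ℕ) : Module.End ℂ (SpinSpace N k) :=
  (2 * (Real.pi : ℂ) ^ 2 / (N : ℂ) ^ 2) •
    ((∑ α : Fin N, ∑ β ∈ Finset.univ.erase α, invDistSq α β • spinDot α β)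
    - (1 / (2 * (qn k + 1) * (2 * qn k + 3))) •
      ∑ α : Fin N, ∑ β ∈ Finset.univ.erase α, ∑ γ ∈ Finset.univ.erase α,
        omega α β γ • (spinDot α β * spinDot α γ + spinDot α γ * spinDot α β))

/-- The energy `E_0^S = -(2π²/N²) (s(s+1)²/(2s+3)) (N(N²+5)/12)`. -/
def groundEnergy (N k : ℕ) : ℂ :=
  -(2 * (Real.pi : ℂ) ^ 2 / (N : ℂ) ^ 2) * (qn k * (qn k + 1) ^ 2 / (2 * qn k + 3))
    * ((N : ℂ) * ((N : ℂ) ^ 2 + 5) / 12)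

end SpinChain

end

noncomputable section

namespace SpinChain

section

/-! ### Normal ordering for vector operators coupled to one spin -/

/-! Write Φ for `hsPoly N` and fix a site α. In a weighted sum W = ∑_{β≠α} c_β S_β, the vector index
couples with the spin s at α to angular momentum s-1, s or s+1, and `topProj` extracts the part s+1.
D_α is half of `topProj` of such a W (`chainD_eq_topProj`). A_α is a combination, with operators
multiplied from the left, of `topProj` applied to the sums with weights 1/(η̄_α-η̄_β) and
1/(η_α-η_β) (`chainA_eq_quad`, `IsSpinPair.quad_eq_topProj`). It therefore suffices that these
projections kill Φ^(2s).

Suppose that W Φ = S_α g for some g with one boson at α. Spins are derivations, so W Φ^(2s) = 2s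
Φ^(2s-1) S_α g. The vector S_α g carries angular momentum 1/2 and Φ^(2s-1) carries s-1/2, so the
product reaches at most s and its s+1 part vanishes (`top_component_pow_mul`).

For the weights 1/(η_α-η_β), such a g comes from the wave function: power sums of roots of unity
show that ∑ c_β S⁻_β Φ has no a-boson at α (`pderiv_sum_lower_hsPoly`). Since Φ is a singlet
(`raiseTot_hsPoly`), raising this vector yields the other components and the vector g
(`exists_linear_fockSpin`). The remaining weights are combinations of these and of constant weights.

The sum rules for Λ and Υ are operator identities based on lattice sums of the coefficients; with
S_tot ψ = 0 they give the annihilation by Λ and Υ. The Hamiltonian comes from contracting A_α with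
S_α (`IsSpinPair.dot_quad`) and summing ω_{αβγ} over α (`IsSpinChain.sum_omega_dot`). -/

theorem sum_fin_three_cyclic {R : Type*} [AddCommMonoid R] (f : Fin 3 → R) (i : Fin 3) :
    ∑ j, f j = f i + f (i + 1) + f (i + 2) := by
  fin_cases i <;> simp [Fin.sum_univ_three] <;> abel

theorem fin_three_add (i : Fin 3) :
    i + 1 + 1 = i + 2 ∧ i + 1 + 2 = i ∧ i + 2 + 1 = i ∧ i + 2 + 2 = i + 1 := by
  fin_cases i <;> exact ⟨rfl, rfl, rfl, rfl⟩

theorem mul_mul_of_mul_eq {R : Type*} [Semigroup R] {a b c : R} (h : a * b = c) (x : R) :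
    a * (b * x) = c * x := by
  rw [← mul_assoc, h]

section VectorOperators

variable {R : Type*} [Ring R] [Algebra ℂ R]

/-- `i S × W + (s + 1) W - S (S · W) / (s + 1)`, which is `2s + 1` times the projection of the
vector operator `W` to total angular momentum `s + 1`, when `S` is a spin `s` commuting with
`W`. -/
def topProj (s : ℂ) (S W : Fin 3 → R) (i : Fin 3) : R :=
  Complex.I • cross S W i + (s + 1) • W i - (1 / (s + 1)) • (S i * dot S W)

/-- A spin `S` of quantum number `s` and vector operators `U`, `W` commuting with it, whose mutual
commutators `[U i, W j] = i ε_{ijk} V k` are given by a further vector operator `V`. -/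
structure IsSpinPair (s : ℂ) (S U W V : Fin 3 → R) : Prop where
  spin_comm : ∀ i, S (i + 1) * S (i + 2) - S (i + 2) * S (i + 1) = Complex.I • S i
  casimir : dot S S = (s * (s + 1)) • (1 : R)
  commute_left : ∀ i j, Commute (S i) (U j)
  commute_right : ∀ i j, Commute (S i) (W j)
  commute_bracket : ∀ i j, Commute (S i) (V j)
  commute_same : ∀ i, Commute (U i) (W i)
  bracket_pos : ∀ i, U (i + 1) * W (i + 2) - W (i + 2) * U (i + 1) = Complex.I • V i
  bracket_neg : ∀ i, U (i + 2) * W (i + 1) - W (i + 1) * U (i + 2) = -(Complex.I • V i)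

namespace IsSpinPair

variable {s : ℂ} {S U W V : Fin 3 → R}

/-- Rewriting rules for a normal form: factors of `S` appear in the order `i`, `i + 1`, `i + 2`, and
the Casimir relation eliminates the square of the last one. With `pair_reorder`, identities reduce
to a comparison of scalar coefficients. -/
theorem spin_reorder (h : IsSpinPair s S U W V) (i : Fin 3) :
    S (i + 2) * S (i + 1) = S (i + 1) * S (i + 2) - Complex.I • S i ∧
    S (i + 2) * S i = S i * S (i + 2) + Complex.I • S (i + 1) ∧
    S (i + 1) * S i = S i * S (i + 1) - Complex.I • S (i + 2) ∧
    S (i + 2) * S (i + 2)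
      = (s * (s + 1)) • (1 : R) - S i * S i - S (i + 1) * S (i + 1) := by
  obtain ⟨e1, e2, e3, e4⟩ := fin_three_add i
  have a0 := h.spin_comm i
  have a1 := h.spin_comm (i + 1)
  have a2 := h.spin_comm (i + 2)
  have hS := h.casimir
  simp only [dot, sum_fin_three_cyclic _ i] at hS
  simp only [e1, e2, e3, e4] at a1 a2
  refine ⟨?_, ?_, ?_, ?_⟩
  · rw [← a0]; abel
  · rw [← a1]; abel
  · rw [← a2]; abel
  · rw [← hS]; abel

theorem pair_reorder (h : IsSpinPair s S U W V) (i : Fin 3) :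
    W (i + 2) * U (i + 1) = U (i + 1) * W (i + 2) - Complex.I • V i ∧
    W i * U (i + 2) = U (i + 2) * W i - Complex.I • V (i + 1) ∧
    W (i + 1) * U i = U i * W (i + 1) - Complex.I • V (i + 2) ∧
    W (i + 1) * U (i + 2) = U (i + 2) * W (i + 1) + Complex.I • V i ∧
    W (i + 2) * U i = U i * W (i + 2) + Complex.I • V (i + 1) ∧
    W i * U (i + 1) = U (i + 1) * W i + Complex.I • V (i + 2) := by
  obtain ⟨e1, e2, e3, e4⟩ := fin_three_add i
  have b0 := h.bracket_pos i
  have b1 := h.bracket_pos (i + 1)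
  have b2 := h.bracket_pos (i + 2)
  have c0 := h.bracket_neg i
  have c1 := h.bracket_neg (i + 1)
  have c2 := h.bracket_neg (i + 2)
  simp only [e1, e2, e3, e4] at b1 b2 c1 c2
  refine ⟨?_, ?_, ?_, ?_, ?_, ?_⟩
  · rw [← b0]; abel
  · rw [← b1]; abel
  · rw [← b2]; abel
  · rw [← neg_neg (Complex.I • V i), ← c0]; abel
  · rw [← neg_neg (Complex.I • V (i + 1)), ← c1]; abel
  · rw [← neg_neg (Complex.I • V (i + 2)), ← c2]; abel

/-- The quadratic vector operator built from `U` and `W`. -/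
def quad (s : ℂ) (S U W V : Fin 3 → R) (i : Fin 3) : R :=
  (S i * dot S V + dot S V * S i + (2 * (s + 1)) • V i)
    + (-((1 / (s + 1)) • (dot S U * S i * dot S W + dot S W * S i * dot S U))
      + ((2 * (s + 2)) • (S i * dot U W) - U i * dot S W - dot S U * W i))

-- The projections stand rightmost in every product, so a vector killed by both of them is killed by
-- `quad`. The proof normal-orders both sides (`S` first, then `U`, then `W`); the commutators of
-- `U` and `W` supply the terms in `V`.
set_option maxHeartbeats 4000000 in
theorem quad_eq_topProj (h : IsSpinPair s S U W V) (hs : s + 1 ≠ 0) (i : Fin 3) :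
    quad s S U W V i
      = (S i * dot U (topProj s S W) - Complex.I • cross U (topProj s S W) i)
        + (S i * dot W (topProj s S U) - Complex.I • cross W (topProj s S U) i) := by
  obtain ⟨e1, e2, e3, e4⟩ := fin_three_add i
  obtain ⟨r1, r2, r3, r4⟩ := h.spin_reorder i
  obtain ⟨t0, t1, t2, t3, t4, t5⟩ := h.pair_reorder i
  have g0 := (h.commute_same i).eq.symm
  have g1 := (h.commute_same (i + 1)).eq.symm
  have g2 := (h.commute_same (i + 2)).eq.symm
  have su := fun j l => (h.commute_left j l).eq.symm
  have sw := fun j l => (h.commute_right j l).eq.symm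
  have sv := fun j l => (h.commute_bracket j l).eq.symm
  have R1 := mul_mul_of_mul_eq r1
  have R2 := mul_mul_of_mul_eq r2
  have R3 := mul_mul_of_mul_eq r3
  have R4 := mul_mul_of_mul_eq r4
  have su' := fun j l => mul_mul_of_mul_eq (su j l)
  have sw' := fun j l => mul_mul_of_mul_eq (sw j l)
  simp only [quad, topProj, cross, dot, sum_fin_three_cyclic _ i, e1, e2, e3, e4, mul_add,
    add_mul, mul_sub, sub_mul, smul_add, smul_sub, smul_smul, smul_mul_assoc, mul_smul_comm,
    mul_assoc, su, sw, sv, su', sw', R1, R2, R3, R4, t0, t1, t2, t3, t4, t5, g0, g1, g2,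
    one_mul]
  match_scalars
  all_goals (field_simp; ring_nf; try simp only [Complex.I_sq]; try ring_nf)

-- Contraction with `S` turns the five-spin term into the four-spin term of the Hamiltonian. Same
-- normal ordering as above, based at the index 0.
set_option maxHeartbeats 4000000 in
theorem dot_quad (h : IsSpinPair s S U W V) (hs : s + 1 ≠ 0) :
    dot S (quad s S U W V)
      = (2 * s * (s + 2)) • dot S V
        - (s * (s + 2) / (s + 1)) • (dot S U * dot S W + dot S W * dot S U)
        + (2 * s * (s + 1) * (s + 2)) • dot U W := by
  obtain ⟨r1, r2, r3, r4⟩ := h.spin_reorder 0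
  obtain ⟨t0, t1, t2, t3, t4, t5⟩ := h.pair_reorder 0
  have g0 := (h.commute_same 0).eq.symm
  have g1 := (h.commute_same (0 + 1)).eq.symm
  have g2 := (h.commute_same (0 + 2)).eq.symm
  have su := fun j l => (h.commute_left j l).eq.symm
  have sw := fun j l => (h.commute_right j l).eq.symm
  have sv := fun j l => (h.commute_bracket j l).eq.symm
  have R1 := mul_mul_of_mul_eq r1
  have R2 := mul_mul_of_mul_eq r2
  have R3 := mul_mul_of_mul_eq r3
  have R4 := mul_mul_of_mul_eq r4
  have su' := fun j l => mul_mul_of_mul_eq (su j l)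
  have sw' := fun j l => mul_mul_of_mul_eq (sw j l)
  simp only [quad, dot, sum_fin_three_cyclic _ 0, mul_add,
    add_mul, mul_sub, sub_mul, smul_add, smul_sub, smul_smul, smul_mul_assoc, mul_smul_comm,
    mul_neg, neg_add, neg_sub,
    mul_assoc, su, sw, sv, su', sw', R1, R2, R3, R4, t0, t1, t2, t3, t4, t5, g0, g1, g2,
    one_mul]
  match_scalars
  all_goals (field_simp; ring_nf; try simp only [Complex.I_sq, Complex.I_pow_four]; try ring_nf)

end IsSpinPair

end VectorOperators

end

section

open MvPolynomial

/-! ### One spin in the Schwinger boson representation -/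

/-- `S⁺ = a† b`. -/
def raise {N : ℕ} (α : Fin N) : Module.End ℂ (Fock N) :=
  create (α, true) * annihilate (α, false)

/-- `S⁻ = b† a`. -/
def lower {N : ℕ} (α : Fin N) : Module.End ℂ (Fock N) :=
  create (α, false) * annihilate (α, true)

/-- `2 Sᶻ = a† a - b† b`. -/
def weight {N : ℕ} (α : Fin N) : Module.End ℂ (Fock N) :=
  create (α, true) * annihilate (α, true) - create (α, false) * annihilate (α, false)

variable {N : ℕ}

theorem raise_apply (α : Fin N) (p : Fock N) :
    raise α p = X (α, true) * pderiv (α, false) p := rfl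

theorem lower_apply (α : Fin N) (p : Fock N) :
    lower α p = X (α, false) * pderiv (α, true) p := rfl

theorem weight_apply (α : Fin N) (p : Fock N) :
    weight α p = X (α, true) * pderiv (α, true) p - X (α, false) * pderiv (α, false) p := rfl

theorem fockSpin_zero (α : Fin N) : fockSpin α 0 = (1 / 2 : ℂ) • (raise α + lower α) := rfl

theorem fockSpin_one (α : Fin N) : fockSpin α 1 = (-Complex.I / 2) • (raise α - lower α) := rfl

theorem fockSpin_two (α : Fin N) : fockSpin α 2 = (1 / 2 : ℂ) • weight α := rfl

theorem raise_lower (α : Fin N) : raise α * lower α - lower α * raise α = weight α := by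
  refine LinearMap.ext fun p => ?_
  simp only [LinearMap.sub_apply, Module.End.mul_apply, raise_apply, lower_apply, weight_apply,
    pderiv_mul, pderiv_X, Pi.single_apply, pderiv_comm' (α, false) (α, true)]
  simp
  ring

theorem weight_raise (α : Fin N) :
    weight α * raise α - raise α * weight α = (2 : ℂ) • raise α := by
  refine LinearMap.ext fun p => ?_
  simp only [LinearMap.sub_apply, Module.End.mul_apply, raise_apply, weight_apply, map_sub,
    pderiv_mul, pderiv_X, Pi.single_apply, pderiv_comm' (α, false) (α, true),
    LinearMap.smul_apply, ofNat_smul_eq_nsmul]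
  simp
  ring

theorem weight_lower (α : Fin N) :
    weight α * lower α - lower α * weight α = -(2 : ℂ) • lower α := by
  refine LinearMap.ext fun p => ?_
  simp only [LinearMap.sub_apply, Module.End.mul_apply, lower_apply, weight_apply, map_sub,
    pderiv_mul, pderiv_X, Pi.single_apply, pderiv_comm' (α, false) (α, true),
    LinearMap.smul_apply, neg_smul, ofNat_smul_eq_nsmul]
  simp
  ring

theorem casimir_raise_lower (α : Fin N) :
    (2 : ℂ) • (raise α * lower α + lower α * raise α) + weight α * weight α
      = bosonNumber α * bosonNumber α + (2 : ℂ) • bosonNumber α := by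
  refine LinearMap.ext fun p => ?_
  simp only [Module.End.mul_apply, raise_apply, lower_apply, weight_apply,
    map_sub, map_add, LinearMap.add_apply, bosonNumber_apply,
    pderiv_mul, pderiv_X, Pi.single_apply, pderiv_comm' (α, false) (α, true),
    LinearMap.smul_apply, ofNat_smul_eq_nsmul]
  simp
  ring

theorem fockSpin_comm (α : Fin N) (i : Fin 3) :
    fockSpin α (i + 1) * fockSpin α (i + 2) - fockSpin α (i + 2) * fockSpin α (i + 1)
      = Complex.I • fockSpin α i := by
  have h1 := raise_lower α
  have h2 := weight_raise α
  have h3 := weight_lower α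
  rw [sub_eq_iff_eq_add] at h1 h2 h3
  fin_cases i
  · change fockSpin α 1 * fockSpin α 2 - fockSpin α 2 * fockSpin α 1 = Complex.I • fockSpin α 0
    simp only [fockSpin_zero, fockSpin_one, fockSpin_two, smul_mul_assoc, mul_smul_comm,
      mul_sub, sub_mul, h2, h3]
    match_scalars <;> ring_nf
  · change fockSpin α 2 * fockSpin α 0 - fockSpin α 0 * fockSpin α 2 = Complex.I • fockSpin α 1
    simp only [fockSpin_zero, fockSpin_one, fockSpin_two, smul_mul_assoc, mul_smul_comm, mul_add,
      add_mul, h2, h3]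
    match_scalars <;> ring_nf <;> simp [Complex.I_sq] <;> ring_nf
  · change fockSpin α 0 * fockSpin α 1 - fockSpin α 1 * fockSpin α 0 = Complex.I • fockSpin α 2
    simp only [fockSpin_zero, fockSpin_one, fockSpin_two, smul_mul_assoc, mul_smul_comm, mul_add,
      add_mul, mul_sub, sub_mul, h1]
    match_scalars <;> ring_nf

theorem dot_fockSpin (α : Fin N) :
    dot (fockSpin α) (fockSpin α)
      = (1 / 4 : ℂ) • (bosonNumber α * bosonNumber α + (2 : ℂ) • bosonNumber α) := by
  rw [← casimir_raise_lower, dot, Fin.sum_univ_three, fockSpin_zero, fockSpin_one, fockSpin_two]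
  simp only [smul_mul_assoc, mul_smul_comm, mul_add, add_mul, mul_sub, sub_mul]
  match_scalars <;> ring_nf <;> simp [Complex.I_sq] <;> ring_nf

theorem commute_hop {α β : Fin N} (h : α ≠ β) (a b c d : Bool) :
    Commute (create (α, a) * annihilate (α, b)) (create (β, c) * annihilate (β, d)) := by
  refine LinearMap.ext fun p => ?_
  change X (α, a) * pderiv (α, b) (X (β, c) * pderiv (β, d) p)
    = X (β, c) * pderiv (β, d) (X (α, a) * pderiv (α, b) p)
  simp only [pderiv_mul, pderiv_X, Pi.single_apply, pderiv_comm' (β, d) (α, b), Prod.mk.injEq,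
    h, h.symm, false_and, if_false, zero_mul, zero_add]
  ring

theorem commute_fockSpin {α β : Fin N} (h : α ≠ β) (i j : Fin 3) :
    Commute (fockSpin α i) (fockSpin β j) := by
  have hc := commute_hop h
  fin_cases i <;> fin_cases j <;>
    simp only [fockSpin] <;>
    refine Commute.smul_left (Commute.smul_right ?_ _) _ <;>
    simp [Commute.add_left, Commute.add_right, Commute.sub_left, Commute.sub_right, hc]

/-- Spin operators are first-order differential operators in the creation variables, hence
derivations. -/
theorem fockSpin_mul (α : Fin N) (i : Fin 3) (p q : Fock N) :
    fockSpin α i (p * q) = fockSpin α i p * q + p * fockSpin α i q := by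
  fin_cases i
  · change fockSpin α 0 _ = fockSpin α 0 _ * _ + _ * fockSpin α 0 _
    simp only [fockSpin_zero, LinearMap.smul_apply, LinearMap.add_apply, raise_apply, lower_apply,
      pderiv_mul, smul_eq_C_mul]
    ring
  · change fockSpin α 1 _ = fockSpin α 1 _ * _ + _ * fockSpin α 1 _
    simp only [fockSpin_one, LinearMap.smul_apply, LinearMap.sub_apply, raise_apply, lower_apply,
      pderiv_mul, smul_eq_C_mul]
    ring
  · change fockSpin α 2 _ = fockSpin α 2 _ * _ + _ * fockSpin α 2 _
    simp only [fockSpin_two, LinearMap.smul_apply, weight_apply,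
      pderiv_mul, smul_eq_C_mul]
    ring

/-- The witness `t` plays the role of `n p^(n-1)`; leaving it implicit avoids a truncated exponent
at `n = 0`. -/
theorem exists_fockSpin_pow (p : Fock N) (n : ℕ) :
    ∃ t : Fock N, (n : ℂ) • p ^ n = t * p ∧
      ∀ (α : Fin N) (i : Fin 3), fockSpin α i (p ^ n) = t * fockSpin α i p := by
  induction n with
  | zero =>
    refine ⟨0, by simp, fun α i => ?_⟩
    have h := fockSpin_mul α i 1 1
    simp only [mul_one, one_mul, left_eq_add] at h
    simp [h]
  | succ n ih =>
    obtain ⟨t, ht, h⟩ := ih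
    refine ⟨t * p + p ^ n, ?_, fun α i => ?_⟩
    · rw [← ht, Nat.cast_succ, add_smul, one_smul, pow_succ, add_mul, smul_mul_assoc]
    · rw [pow_succ, fockSpin_mul, h]
      ring

end

section

open MvPolynomial

variable {N : ℕ}

/-! ### Polynomials of degree one in the bosons of a site -/

/-- `p` does not involve the bosons of the site `α`. -/
def IsFreeAt (α : Fin N) (p : Fock N) : Prop := ∀ c, pderiv (α, c) p = 0

/-- `p` has exactly one boson at the site `α`. -/
def IsLinearAt (α : Fin N) (p : Fock N) : Prop :=
  ∃ u v : Fock N, IsFreeAt α u ∧ IsFreeAt α v ∧ p = X (α, true) * u + X (α, false) * v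

theorem IsFreeAt.zero (α : Fin N) : IsFreeAt α 0 := fun _ => map_zero _

theorem IsFreeAt.add {α : Fin N} {p q : Fock N} (hp : IsFreeAt α p) (hq : IsFreeAt α q) :
    IsFreeAt α (p + q) := fun c => by rw [map_add, hp, hq, add_zero]

theorem IsFreeAt.smul {α : Fin N} {p : Fock N} (a : ℂ) (hp : IsFreeAt α p) :
    IsFreeAt α (a • p) := fun c => by rw [Derivation.map_smul, hp, smul_zero]

theorem IsFreeAt.mul {α : Fin N} {p q : Fock N} (hp : IsFreeAt α p) (hq : IsFreeAt α q) :
    IsFreeAt α (p * q) := fun c => by rw [pderiv_mul, hp, hq, zero_mul, mul_zero, add_zero]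

theorem IsFreeAt.X {α β : Fin N} (h : β ≠ α) (c : Bool) : IsFreeAt α (X (β, c) : Fock N) :=
  fun _ => pderiv_X_of_ne fun e => h (congrArg Prod.fst e)

theorem IsFreeAt.sum {ι : Type*} {α : Fin N} (s : Finset ι) {f : ι → Fock N}
    (h : ∀ i ∈ s, IsFreeAt α (f i)) : IsFreeAt α (∑ i ∈ s, f i) :=
  fun c => by rw [map_sum]; exact Finset.sum_eq_zero fun i hi => h i hi c

theorem IsFreeAt.prod {α : Fin N} (s : Finset (Fin N)) (c : Bool) (h : α ∉ s) :
    IsFreeAt α (∏ β ∈ s, MvPolynomial.X (β, c) : Fock N) := by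
  induction s using Finset.induction_on with
  | empty => intro c; simp
  | insert β s hβ ih =>
    rw [Finset.prod_insert hβ]
    rw [Finset.mem_insert, not_or] at h
    exact (IsFreeAt.X (Ne.symm h.1) c).mul (ih h.2)

theorem IsFreeAt.pderiv {α : Fin N} {p : Fock N} (hp : IsFreeAt α p) (j : Fin N × Bool) :
    IsFreeAt α (MvPolynomial.pderiv j p) := fun c => by rw [pderiv_comm', hp, map_zero]

theorem IsFreeAt.raise {α β : Fin N} (h : β ≠ α) {p : Fock N} (hp : IsFreeAt α p) :
    IsFreeAt α (raise β p) := (IsFreeAt.X h _).mul (hp.pderiv _)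

theorem IsFreeAt.lower {α β : Fin N} (h : β ≠ α) {p : Fock N} (hp : IsFreeAt α p) :
    IsFreeAt α (lower β p) := (IsFreeAt.X h _).mul (hp.pderiv _)

theorem IsLinearAt.zero (α : Fin N) : IsLinearAt α 0 :=
  ⟨0, 0, IsFreeAt.zero α, IsFreeAt.zero α, by simp⟩

theorem IsLinearAt.add {α : Fin N} {p q : Fock N} (hp : IsLinearAt α p) (hq : IsLinearAt α q) :
    IsLinearAt α (p + q) := by
  obtain ⟨u, v, hu, hv, rfl⟩ := hp
  obtain ⟨u', v', hu', hv', rfl⟩ := hq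
  exact ⟨u + u', v + v', hu.add hu', hv.add hv', by ring⟩

theorem IsLinearAt.smul {α : Fin N} {p : Fock N} (a : ℂ) (hp : IsLinearAt α p) :
    IsLinearAt α (a • p) := by
  obtain ⟨u, v, hu, hv, rfl⟩ := hp
  exact ⟨a • u, a • v, hu.smul a, hv.smul a, by simp⟩

theorem IsLinearAt.sum {ι : Type*} {α : Fin N} (s : Finset ι) {f : ι → Fock N}
    (h : ∀ i ∈ s, IsLinearAt α (f i)) : IsLinearAt α (∑ i ∈ s, f i) := by
  classical
  induction s using Finset.induction_on with
  | empty => exact IsLinearAt.zero α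
  | insert i s hi ih =>
    rw [Finset.sum_insert hi]
    exact (h i (Finset.mem_insert_self i s)).add
      (ih fun j hj => h j (Finset.mem_insert_of_mem hj))

theorem IsLinearAt.lower {α β : Fin N} (h : β ≠ α) {p : Fock N} (hp : IsLinearAt α p) :
    IsLinearAt α (SpinChain.lower β p) := by
  obtain ⟨u, v, hu, hv, rfl⟩ := hp
  refine ⟨SpinChain.lower β u, SpinChain.lower β v, hu.lower h, hv.lower h, ?_⟩
  simp only [lower_apply, map_add, pderiv_mul, IsFreeAt.X h.symm _ _]
  ring

section Values

variable {α : Fin N} {u v : Fock N} (hu : IsFreeAt α u) (hv : IsFreeAt α v)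

include hu hv

theorem pderiv_true_linear :
    pderiv (α, true) (X (α, true) * u + X (α, false) * v) = u := by
  simp [pderiv_X, hu true, hv true]

theorem pderiv_false_linear :
    pderiv (α, false) (X (α, true) * u + X (α, false) * v) = v := by
  simp [pderiv_X, hu false, hv false]

theorem fockSpin_zero_linear :
    fockSpin α 0 (X (α, true) * u + X (α, false) * v)
      = C (1 / 2) * (X (α, true) * v + X (α, false) * u) := by
  rw [fockSpin_zero, LinearMap.smul_apply, LinearMap.add_apply, raise_apply, lower_apply,
    pderiv_true_linear hu hv, pderiv_false_linear hu hv, smul_eq_C_mul]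

theorem fockSpin_one_linear :
    fockSpin α 1 (X (α, true) * u + X (α, false) * v)
      = C (-Complex.I / 2) * (X (α, true) * v - X (α, false) * u) := by
  rw [fockSpin_one, LinearMap.smul_apply, LinearMap.sub_apply, raise_apply, lower_apply,
    pderiv_true_linear hu hv, pderiv_false_linear hu hv, smul_eq_C_mul]

theorem fockSpin_two_linear :
    fockSpin α 2 (X (α, true) * u + X (α, false) * v)
      = C (1 / 2) * (X (α, true) * u - X (α, false) * v) := by
  rw [fockSpin_two, LinearMap.smul_apply, weight_apply,
    pderiv_true_linear hu hv, pderiv_false_linear hu hv, smul_eq_C_mul]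

end Values

theorem dot_fockSpin_linear {α : Fin N} {p : Fock N} (hp : IsLinearAt α p) :
    ∑ i, fockSpin α i (fockSpin α i p) = (3 / 4 : ℂ) • p := by
  have hb : bosonNumber α p = p := by
    obtain ⟨u, v, hu, hv, rfl⟩ := hp
    rw [bosonNumber_apply, pderiv_true_linear hu hv, pderiv_false_linear hu hv]
  have h := LinearMap.congr_fun (dot_fockSpin α) p
  simp only [dot, LinearMap.sum_apply, Module.End.mul_apply, LinearMap.smul_apply,
    LinearMap.add_apply, hb] at h
  rw [h]
  module

/-- Multiplying two one-boson states symmetrises two spins 1/2, and S₁·S₂ = 1/4 on the triplet. -/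
theorem sum_fockSpin_mul_fockSpin {α : Fin N} {p q : Fock N} (hp : IsLinearAt α p)
    (hq : IsLinearAt α q) :
    ∑ i, fockSpin α i p * fockSpin α i q = (1 / 4 : ℂ) • (p * q) := by
  obtain ⟨u, v, hu, hv, rfl⟩ := hp
  obtain ⟨u', v', hu', hv', rfl⟩ := hq
  simp only [Fin.sum_univ_three, fockSpin_zero_linear, fockSpin_one_linear, fockSpin_two_linear,
    hu, hv, hu', hv', smul_eq_C_mul]
  have h1 : C (-Complex.I / 2) * C (-Complex.I / 2) = (-C (1 / 4) : Fock N) := by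
    rw [← C_mul, ← C_neg]; congr 1; linear_combination (1 / 4) * Complex.I_sq
  have h2 : C (1 / 2) * C (1 / 2) = (C (1 / 4) : Fock N) := by
    rw [← C_mul]; norm_num
  linear_combination ((X (α, true) * v - X (α, false) * u)
    * (X (α, true) * v' - X (α, false) * u')) * h1
    + ((X (α, true) * v + X (α, false) * u) * (X (α, true) * v' + X (α, false) * u')
    + (X (α, true) * u - X (α, false) * v) * (X (α, true) * u' - X (α, false) * v')) * h2

/-- Again only the triplet part survives multiplication. After that projection, i S₁ × S₂ and (S₁ -
S₂)/2 both vanish on symmetric pairs and agree on antisymmetric ones. -/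
theorem cross_fockSpin_mul_fockSpin {α : Fin N} {p q : Fock N} (hp : IsLinearAt α p)
    (hq : IsLinearAt α q) (i : Fin 3) :
    Complex.I • (fockSpin α (i + 1) p * fockSpin α (i + 2) q
        - fockSpin α (i + 2) p * fockSpin α (i + 1) q)
      = (1 / 2 : ℂ) • (fockSpin α i p * q - p * fockSpin α i q) := by
  obtain ⟨u, v, hu, hv, rfl⟩ := hp
  obtain ⟨u', v', hu', hv', rfl⟩ := hq
  have hI : (C Complex.I : Fock N) ^ 2 = -1 := by
    rw [← C_pow, Complex.I_sq, C_neg, C_1]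
  have h1 : (C (-Complex.I / 2) : Fock N) = -(C Complex.I * C (1 / 2)) := by
    rw [← C_mul, ← C_neg]; congr 1; ring
  have h2 : 2 * C (1 / 2) = (1 : Fock N) := by
    rw [show (2 : Fock N) = C 2 from rfl, ← C_mul]; norm_num
  fin_cases i
  · change Complex.I • (fockSpin α 1 _ * fockSpin α 2 _ - fockSpin α 2 _ * fockSpin α 1 _)
      = (1 / 2 : ℂ) • (fockSpin α 0 _ * _ - _ * fockSpin α 0 _)
    simp only [fockSpin_zero_linear, fockSpin_one_linear, fockSpin_two_linear,
      hu, hv, hu', hv', smul_eq_C_mul, h1]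
    ring_nf
    rw [hI]
    ring
  · change Complex.I • (fockSpin α 2 _ * fockSpin α 0 _ - fockSpin α 0 _ * fockSpin α 2 _)
      = (1 / 2 : ℂ) • (fockSpin α 1 _ * _ - _ * fockSpin α 1 _)
    simp only [fockSpin_zero_linear, fockSpin_one_linear, fockSpin_two_linear,
      hu, hv, hu', hv', smul_eq_C_mul, h1]
    ring
  · change Complex.I • (fockSpin α 0 _ * fockSpin α 1 _ - fockSpin α 1 _ * fockSpin α 0 _)
      = (1 / 2 : ℂ) • (fockSpin α 2 _ * _ - _ * fockSpin α 2 _)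
    simp only [fockSpin_zero_linear, fockSpin_one_linear, fockSpin_two_linear,
      hu, hv, hu', hv', smul_eq_C_mul, h1]
    ring_nf
    rw [hI]
    ring

/-! ### Vanishing of the component of angular momentum s + 1. -/

theorem dot_fockSpin_pow_mul {α : Fin N} {p g : Fock N} (hp : IsLinearAt α p)
    (hg : IsLinearAt α g) (n : ℕ) :
    ∑ j, fockSpin α j (p ^ n * fockSpin α j g) = (((n : ℂ) + 3) / 4) • (p ^ n * g) := by
  obtain ⟨t, ht, hpow⟩ := exists_fockSpin_pow p n
  have h1 := sum_fockSpin_mul_fockSpin hp hg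
  have h2 := dot_fockSpin_linear hg
  simp only [fockSpin_mul, hpow, Finset.sum_add_distrib, mul_assoc]
  rw [← Finset.mul_sum, ← Finset.mul_sum, h1, h2, mul_smul_comm, ← mul_assoc, ← ht,
    smul_mul_assoc, mul_smul_comm]
  module

/-- With `n + 1` bosons at the site, s = (n+1)/2. The factor `p ^ n` has spin n/2 and the vector of
all `fockSpin α i g` has coupled angular momentum 1/2, so s + 1 is out of reach. The computation
expands by Leibniz and uses the two triplet identities. -/
theorem top_component_pow_mul {α : Fin N} {p g : Fock N} (hp : IsLinearAt α p)
    (hg : IsLinearAt α g) (n : ℕ) (i : Fin 3) :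
    Complex.I • (fockSpin α (i + 1) (p ^ n * fockSpin α (i + 2) g)
        - fockSpin α (i + 2) (p ^ n * fockSpin α (i + 1) g))
      + (qn (n + 1) + 1) • (p ^ n * fockSpin α i g)
      - (1 / (qn (n + 1) + 1)) •
        fockSpin α i (∑ j, fockSpin α j (p ^ n * fockSpin α j g)) = 0 := by
  obtain ⟨t, ht, hpow⟩ := exists_fockSpin_pow p n
  have hs : (n : ℂ) + 3 ≠ 0 := by exact_mod_cast (by omega : n + 3 ≠ 0)
  have hq : qn (n + 1) + 1 = ((n : ℂ) + 3) / 2 := by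
    rw [qn]; push_cast; ring
  have hc := cross_fockSpin_mul_fockSpin hp hg i
  have hd := LinearMap.congr_fun (fockSpin_comm α i) g
  simp only [LinearMap.sub_apply, Module.End.mul_apply, LinearMap.smul_apply] at hd
  have h3 : Complex.I • (fockSpin α (i + 1) (p ^ n * fockSpin α (i + 2) g)
        - fockSpin α (i + 2) (p ^ n * fockSpin α (i + 1) g))
      = t * (Complex.I • (fockSpin α (i + 1) p * fockSpin α (i + 2) g
        - fockSpin α (i + 2) p * fockSpin α (i + 1) g))
        + p ^ n * (Complex.I • (fockSpin α (i + 1) (fockSpin α (i + 2) g)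
          - fockSpin α (i + 2) (fockSpin α (i + 1) g))) := by
    simp only [fockSpin_mul, hpow, smul_eq_C_mul]
    ring
  rw [h3, hc, hd, smul_smul, Complex.I_mul_I, dot_fockSpin_pow_mul hp hg, map_smul, fockSpin_mul,
    hpow, hq, smul_smul]
  have h4 : 1 / (((n : ℂ) + 3) / 2) * (((n : ℂ) + 3) / 4) = 1 / 2 := by
    field_simp; norm_num
  have h5 : t * ((1 / 2 : ℂ) • (fockSpin α i p * g - p * fockSpin α i g))
      = (1 / 2 : ℂ) • (t * fockSpin α i p * g)
        - (1 / 2 : ℂ) • (((n : ℂ) • p ^ n) * fockSpin α i g) := by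
    rw [ht]; simp only [smul_eq_C_mul]; ring
  rw [h4, h5]
  simp only [mul_smul_comm, smul_mul_assoc]
  module

end

section

open MvPolynomial

variable {N : ℕ}

/-! ### Sums over the sites of the ring -/

theorem eta_eq_pow (α : Fin N) :
    eta α = Complex.exp (2 * Real.pi * Complex.I / N) ^ ((α : ℕ) + 1) := by
  rw [eta, ← Complex.exp_nat_mul]
  congr 1
  push_cast
  ring

theorem eta_pow_card (hN : 0 < N) (α : Fin N) : eta α ^ N = 1 := by
  rw [eta_eq_pow, pow_right_comm, (Complex.isPrimitiveRoot_exp N hN.ne').pow_eq_one, one_pow]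

theorem eta_ne_zero (α : Fin N) : eta α ≠ 0 := Complex.exp_ne_zero _

theorem eta_injective : Function.Injective (eta (N := N)) := by
  intro α β h
  have hN : 0 < N := α.pos
  have hr := Complex.isPrimitiveRoot_exp N hN.ne'
  rw [eta_eq_pow, eta_eq_pow, pow_succ, pow_succ] at h
  exact Fin.ext (hr.pow_inj α.2 β.2 (mul_right_cancel₀ (Complex.exp_ne_zero _) h))

theorem eta_sub_ne_zero {α β : Fin N} (h : α ≠ β) : eta α - eta β ≠ 0 :=
  sub_ne_zero.mpr fun e => h (eta_injective e)

theorem norm_eta (α : Fin N) : ‖eta α‖ = 1 :=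
  Complex.norm_eq_one_of_pow_eq_one (eta_pow_card α.pos α) α.pos.ne'

theorem conj_eta (α : Fin N) : starRingEnd ℂ (eta α) = (eta α)⁻¹ :=
  (Complex.inv_eq_conj (norm_eta α)).symm

theorem sum_eta_pow {m : ℕ} (hm : 0 < m) (hmN : m < N) : ∑ α : Fin N, eta α ^ m = 0 := by
  have hN : 0 < N := hm.trans hmN
  have hr := Complex.isPrimitiveRoot_exp N hN.ne'
  set ζ := Complex.exp (2 * Real.pi * Complex.I / N)
  have h1 : ζ ^ m ≠ 1 := hr.pow_ne_one_of_pos_of_lt hm.ne' hmN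
  have h2 : ∑ i ∈ Finset.range N, (ζ ^ m) ^ i = 0 := by
    rw [geom_sum_eq h1, ← pow_mul, mul_comm, pow_mul, hr.pow_eq_one, one_pow, sub_self, zero_div]
  rw [← Fin.sum_univ_eq_sum_range (fun i => (ζ ^ m) ^ i)] at h2
  have h3 : ∀ α : Fin N, eta α ^ m = ζ ^ m * (ζ ^ m) ^ (α : ℕ) := fun α => by
    rw [eta_eq_pow]; ring
  simp_rw [h3]
  rw [← Finset.mul_sum, h2, mul_zero]

/-- Only exponents divisible by `N` have a nonzero power sum; the degree bound and the vanishing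
constant term exclude them. -/
theorem sum_eval_eta (p : Polynomial ℂ) (hp : p.natDegree < N) (h0 : p.coeff 0 = 0) :
    ∑ α : Fin N, p.eval (eta α) = 0 := by
  simp_rw [Polynomial.eval_eq_sum_range]
  rw [Finset.sum_comm]
  refine Finset.sum_eq_zero fun m hm => ?_
  rw [← Finset.mul_sum]
  rcases Nat.eq_zero_or_pos m with rfl | hpos
  · rw [h0, zero_mul]
  · rw [sum_eta_pow hpos (by rw [Finset.mem_range] at hm; omega), mul_zero]

/-! ### The Haldane–Shastry wave function -/

/-- The configuration with up spins on `A`. -/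
def config (A : Finset (Fin N)) : Fock N := (∏ α ∈ A, X (α, true)) * ∏ α ∈ Aᶜ, X (α, false)

theorem hsPoly_eq (N : ℕ) :
    hsPoly N = ∑ A ∈ (Finset.univ : Finset (Fin N)).powersetCard (N / 2), hsWave A • config A := rfl

theorem config_eq_of_mem {A : Finset (Fin N)} {α : Fin N} (h : α ∈ A) :
    ∃ u, IsFreeAt α u ∧ config A = X (α, true) * u ∧ config (A.erase α) = X (α, false) * u := by
  refine ⟨(∏ β ∈ A.erase α, X (β, true)) * ∏ β ∈ Aᶜ, X (β, false),
    (IsFreeAt.prod _ _ (by simp)).mul (IsFreeAt.prod _ _ (by simpa using h)), ?_, ?_⟩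
  · rw [config, ← Finset.mul_prod_erase A _ h, mul_assoc]
  · rw [config, Finset.compl_erase, Finset.prod_insert (by simpa using h)]
    ring

theorem config_eq_of_notMem {A : Finset (Fin N)} {α : Fin N} (h : α ∉ A) :
    ∃ u, IsFreeAt α u ∧ config A = X (α, false) * u ∧ config (insert α A) = X (α, true) * u := by
  obtain ⟨u, hu, h1, h2⟩ := config_eq_of_mem (Finset.mem_insert_self α A)
  rw [Finset.erase_insert h] at h2
  exact ⟨u, hu, h2, h1⟩

theorem isLinearAt_config (A : Finset (Fin N)) (α : Fin N) : IsLinearAt α (config A) := by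
  by_cases h : α ∈ A
  · obtain ⟨u, hu, h1, -⟩ := config_eq_of_mem h
    exact ⟨u, 0, hu, IsFreeAt.zero α, by rw [h1, mul_zero, add_zero]⟩
  · obtain ⟨u, hu, h1, -⟩ := config_eq_of_notMem h
    exact ⟨0, u, IsFreeAt.zero α, hu, by rw [h1, mul_zero, zero_add]⟩

theorem isLinearAt_hsPoly (α : Fin N) : IsLinearAt α (hsPoly N) :=
  IsLinearAt.sum _ fun A _ => (isLinearAt_config A α).smul _

theorem pderiv_config (A : Finset (Fin N)) (α : Fin N) (h : α ∉ A) :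
    pderiv (α, true) (config A) = 0 := by
  obtain ⟨u, hu, h1, -⟩ := config_eq_of_notMem h
  rw [h1, pderiv_mul, hu, pderiv_X_of_ne (by simp)]
  simp

theorem lower_config (A : Finset (Fin N)) (α : Fin N) :
    lower α (config A) = if α ∈ A then config (A.erase α) else 0 := by
  split_ifs with h
  · obtain ⟨u, hu, h1, h2⟩ := config_eq_of_mem h
    rw [h1, h2, lower_apply, pderiv_mul, pderiv_X_self, hu]
    simp
  · rw [lower_apply, pderiv_config A α h, mul_zero]

theorem raise_config (A : Finset (Fin N)) (α : Fin N) :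
    raise α (config A) = if α ∈ A then 0 else config (insert α A) := by
  split_ifs with h
  · obtain ⟨u, hu, h1, h2⟩ := config_eq_of_mem h
    rw [h1, raise_apply, pderiv_mul, hu, pderiv_X_of_ne (by simp)]
    simp
  · obtain ⟨u, hu, h1, h2⟩ := config_eq_of_notMem h
    rw [h1, h2, raise_apply, pderiv_mul, pderiv_X_self, hu]
    simp

theorem weight_config (A : Finset (Fin N)) (α : Fin N) :
    weight α (config A) = if α ∈ A then config A else -config A := by
  split_ifs with h
  · obtain ⟨u, hu, h1, h2⟩ := config_eq_of_mem h
    rw [h1, weight_apply, pderiv_mul, pderiv_mul, pderiv_X_self, hu, hu,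
      pderiv_X_of_ne (by simp)]
    simp
  · obtain ⟨u, hu, h1, h2⟩ := config_eq_of_notMem h
    rw [h1, weight_apply, pderiv_mul, pderiv_mul, pderiv_X_self, hu, hu,
      pderiv_X_of_ne (by simp)]
    simp

/-- The squares make the wave function insensitive to the ordering of the sites. -/
theorem hsWave_insert {B : Finset (Fin N)} {β : Fin N} (h : β ∉ B) :
    hsWave (insert β B) = hsWave B * (eta β * ∏ j ∈ B, (eta β - eta j) ^ 2) := by
  have h1 : ∏ i ∈ insert β B, ∏ j ∈ insert β B with i < j, (eta i - eta j) ^ 2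
      = (∏ j ∈ B, (eta β - eta j) ^ 2) * ∏ i ∈ B, ∏ j ∈ B with i < j, (eta i - eta j) ^ 2 := by
    simp_rw [Finset.prod_filter]
    rw [Finset.prod_insert h]
    simp_rw [Finset.prod_insert h]
    rw [Finset.prod_mul_distrib, if_neg (lt_irrefl β), one_mul, ← mul_assoc,
      ← Finset.prod_mul_distrib]
    congr 1
    refine Finset.prod_congr rfl fun j hj => ?_
    have hne : β ≠ j := fun e => h (e ▸ hj)
    rcases lt_or_gt_of_ne hne with hlt | hlt
    · rw [if_pos hlt, if_neg hlt.asymm, mul_one]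
    · rw [if_pos hlt, if_neg hlt.asymm, one_mul]
      ring
  rw [hsWave, hsWave, h1, Finset.prod_insert h]
  ring

theorem lower_hsPoly (hN : 2 ≤ N) (β : Fin N) :
    lower β (hsPoly N) = ∑ B ∈ (Finset.univ : Finset (Fin N)).powersetCard (N / 2 - 1),
      (hsWave B * (eta β * ∏ j ∈ B, (eta β - eta j) ^ 2)) • config B := by
  have hpos : 0 < N / 2 := by omega
  have hz : ∀ B : Finset (Fin N), β ∈ B → ∏ j ∈ B, (eta β - eta j) ^ 2 = 0 := fun B hB =>
    Finset.prod_eq_zero hB (by simp)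
  rw [hsPoly_eq, map_sum]
  simp_rw [map_smul, lower_config, smul_ite, smul_zero]
  rw [← Finset.sum_filter]
  -- The coefficient vanishes when `β ∈ B`, so the sum over all `B` may be restricted to `β ∉ B`,
  -- where inserting `β` inverts erasing it.
  refine Eq.trans ?_ (Finset.sum_filter_of_ne (p := fun B => β ∉ B)
    (fun B _ hB hmem => hB (by rw [hz B hmem]; simp)))
  refine Finset.sum_bij' (fun A _ => A.erase β) (fun B _ => insert β B) ?_ ?_ ?_ ?_ ?_
  · intro A hA
    simp only [Finset.mem_filter, Finset.mem_powersetCard_univ] at hA ⊢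
    exact ⟨by rw [Finset.card_erase_of_mem hA.2, hA.1], Finset.notMem_erase β A⟩
  · intro B hB
    simp only [Finset.mem_filter, Finset.mem_powersetCard_univ] at hB ⊢
    exact ⟨by rw [Finset.card_insert_of_notMem hB.2, hB.1]; omega, Finset.mem_insert_self β B⟩
  · intro A hA
    exact Finset.insert_erase (Finset.mem_filter.mp hA).2
  · intro B hB
    exact Finset.erase_insert (Finset.mem_filter.mp hB).2
  · intro A hA
    rw [← hsWave_insert (Finset.notMem_erase β A),
      Finset.insert_erase (Finset.mem_filter.mp hA).2]

theorem natDegree_prod_sq_le (B : Finset (Fin N)) :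
    (∏ j ∈ B, (Polynomial.X - Polynomial.C (eta j)) ^ 2).natDegree ≤ 2 * B.card := by
  refine (Polynomial.natDegree_prod_le _ _).trans ?_
  rw [mul_comm]
  refine Finset.sum_le_card_nsmul _ _ _ fun j _ => ?_
  exact Polynomial.natDegree_pow_le.trans (by rw [Polynomial.natDegree_X_sub_C])

theorem sum_eta_mul_prod_sq {B : Finset (Fin N)} (hB : 2 * B.card + 1 < N) :
    ∑ β : Fin N, eta β * ∏ j ∈ B, (eta β - eta j) ^ 2 = 0 := by
  have hd : (Polynomial.X * ∏ j ∈ B, (Polynomial.X - Polynomial.C (eta j)) ^ 2).natDegree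
      ≤ 1 + 2 * B.card :=
    Polynomial.natDegree_mul_le.trans
      (add_le_add Polynomial.natDegree_X_le (natDegree_prod_sq_le B))
  have h := sum_eval_eta (N := N) _ (lt_of_le_of_lt hd (by omega)) (by simp)
  simpa [Polynomial.eval_prod] using h

/-- Since `α ∈ B`, one of the two factors `η_β - η_α` cancels the denominator. The other makes the
term `β = α` vanish, so the sum extends to the whole ring. -/
theorem sum_div_eta_mul_prod_sq {B : Finset (Fin N)} {α : Fin N} (hα : α ∈ B)
    (hB : 2 * B.card < N) :
    ∑ β ∈ Finset.univ.erase α,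
      1 / (eta α - eta β) * (eta β * ∏ j ∈ B, (eta β - eta j) ^ 2) = 0 := by
  have hpos : 0 < B.card := Finset.card_pos.mpr ⟨α, hα⟩
  have hd : (Polynomial.X * ((Polynomial.X - Polynomial.C (eta α)) *
      ∏ j ∈ B.erase α, (Polynomial.X - Polynomial.C (eta j)) ^ 2)).natDegree
      ≤ 1 + (1 + 2 * (B.erase α).card) :=
    Polynomial.natDegree_mul_le.trans
      (add_le_add Polynomial.natDegree_X_le (Polynomial.natDegree_mul_le.trans
        (add_le_add (Polynomial.natDegree_X_sub_C_le _) (natDegree_prod_sq_le _))))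
  rw [Finset.card_erase_of_mem hα] at hd
  have h := sum_eval_eta (N := N) _ (lt_of_le_of_lt hd (by omega)) (by simp)
  rw [← Finset.add_sum_erase _ _ (Finset.mem_univ α)] at h
  simp only [Polynomial.eval_mul, Polynomial.eval_sub, Polynomial.eval_X, Polynomial.eval_C,
    Polynomial.eval_prod, Polynomial.eval_pow, sub_self, zero_mul, mul_zero, zero_add] at h
  rw [← neg_eq_zero, ← h, ← Finset.sum_neg_distrib]
  refine Finset.sum_congr rfl fun β hβ => ?_
  have hne := eta_sub_ne_zero (Finset.ne_of_mem_erase hβ).symm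
  rw [← Finset.mul_prod_erase B _ hα]
  field_simp
  ring

theorem sum_lower_hsPoly (hN : 2 ≤ N) : ∑ β : Fin N, lower β (hsPoly N) = 0 := by
  simp_rw [lower_hsPoly hN]
  rw [Finset.sum_comm]
  refine Finset.sum_eq_zero fun B hB => ?_
  rw [Finset.mem_powersetCard_univ] at hB
  rw [← Finset.sum_smul, ← Finset.mul_sum, sum_eta_mul_prod_sq (by omega), mul_zero, zero_smul]

/-- Configurations with `α ∈ B` have total coefficient zero; the others contain no a-boson at `α`.
Here |B| = N/2 - 1, which keeps the polynomial degree below `N`. -/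
theorem pderiv_sum_lower_hsPoly (hN : 2 ≤ N) (α : Fin N) :
    pderiv (α, true) (∑ β ∈ Finset.univ.erase α,
      (1 / (eta α - eta β)) • lower β (hsPoly N)) = 0 := by
  simp_rw [lower_hsPoly hN, Finset.smul_sum, smul_smul]
  rw [Finset.sum_comm, map_sum]
  refine Finset.sum_eq_zero fun B hB => ?_
  rw [Finset.mem_powersetCard_univ] at hB
  rw [← Finset.sum_smul]
  by_cases hα : α ∈ B
  · simp_rw [mul_left_comm _ (hsWave B)]
    rw [← Finset.mul_sum, sum_div_eta_mul_prod_sq hα (by omega), mul_zero, zero_smul, map_zero]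
  · rw [Derivation.map_smul, pderiv_config B α hα, smul_zero]

theorem sum_weight_hsPoly (hN : Even N) : ∑ β : Fin N, weight β (hsPoly N) = 0 := by
  have h : ∀ A ∈ (Finset.univ : Finset (Fin N)).powersetCard (N / 2),
      ∑ β : Fin N, weight β (config A) = 0 := by
    intro A hA
    rw [Finset.mem_powersetCard_univ] at hA
    obtain ⟨m, rfl⟩ := hN
    have h1 : ∑ β ∈ A, weight β (config A) = A.card • config A :=
      Finset.sum_eq_card_nsmul fun β hβ => by rw [weight_config, if_pos hβ]
    have h2 : ∑ β ∈ Aᶜ, weight β (config A) = Aᶜ.card • -config A :=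
      Finset.sum_eq_card_nsmul fun β hβ => by
        rw [weight_config, if_neg (Finset.mem_compl.mp hβ)]
    have h3 : Aᶜ.card = A.card := by rw [Finset.card_compl, Fintype.card_fin, hA]; omega
    rw [← Finset.sum_add_sum_compl A, h1, h2, h3, smul_neg, add_neg_cancel]
  simp_rw [hsPoly_eq, map_sum, map_smul]
  rw [Finset.sum_comm]
  refine Finset.sum_eq_zero fun A hA => ?_
  rw [← Finset.smul_sum, h A hA, smul_zero]

end

section

open MvPolynomial

variable {N : ℕ}

/-! ### The Haldane–Shastry state is a singlet -/

/-- Total raising operator. -/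
def raiseTot : Module.End ℂ (Fock N) := ∑ α, raise α

theorem raise_commute_raise (α β : Fin N) : Commute (raise α) (raise β) := by
  by_cases h : α = β
  · rw [h]
  · exact commute_hop h _ _ _ _

theorem raise_lower_sub (α β : Fin N) :
    raise α * lower β - lower β * raise α = if α = β then weight β else 0 := by
  split_ifs with h
  · rw [h, raise_lower]
  · exact sub_eq_zero.mpr (commute_hop h _ _ _ _).eq

theorem raise_weight_sub (α β : Fin N) :
    raise α * weight β - weight β * raise α = if α = β then -((2 : ℂ) • raise β) else 0 := by
  split_ifs with h
  · rw [h, ← weight_raise]; abel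
  · exact sub_eq_zero.mpr ((commute_hop h _ _ _ _).sub_right (commute_hop h _ _ _ _)).eq

theorem raiseTot_raise (β : Fin N) (p : Fock N) :
    raiseTot (raise β p) = raise β (raiseTot p) := by
  have h : Commute (raiseTot : Module.End ℂ (Fock N)) (raise β) :=
    Commute.sum_left _ _ _ fun α _ => raise_commute_raise α β
  exact LinearMap.congr_fun h.eq p

theorem raiseTot_lower (β : Fin N) (p : Fock N) :
    raiseTot (lower β p) = lower β (raiseTot p) + weight β p := by
  have h : raiseTot * lower β - lower β * raiseTot = (weight β : Module.End ℂ (Fock N)) := by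
    rw [raiseTot, Finset.sum_mul, Finset.mul_sum, ← Finset.sum_sub_distrib]
    simp_rw [raise_lower_sub]
    simp
  have := LinearMap.congr_fun h p
  simp only [LinearMap.sub_apply, Module.End.mul_apply] at this
  rw [← this]
  abel

theorem raiseTot_weight (β : Fin N) (p : Fock N) :
    raiseTot (weight β p) = weight β (raiseTot p) - (2 : ℂ) • raise β p := by
  have h : raiseTot * weight β - weight β * raiseTot
      = -((2 : ℂ) • (raise β : Module.End ℂ (Fock N))) := by
    rw [raiseTot, Finset.sum_mul, Finset.mul_sum, ← Finset.sum_sub_distrib]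
    simp_rw [raise_weight_sub]
    simp
  have := LinearMap.congr_fun h p
  simp only [LinearMap.sub_apply, Module.End.mul_apply, LinearMap.neg_apply,
    LinearMap.smul_apply] at this
  rw [sub_eq_iff_eq_add.mp this]
  abel

theorem raiseTot_pow_mem_span (n m : ℕ) {p : Fock N}
    (hp : p ∈ Submodule.span ℂ (config '' {A : Finset (Fin N) | A.card = m})) :
    (raiseTot ^ n) p ∈ Submodule.span ℂ (config '' {A : Finset (Fin N) | A.card = m + n}) := by
  induction n with
  | zero => simpa using hp
  | succ n ih =>
    rw [pow_succ', Module.End.mul_apply]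
    refine Submodule.span_induction (p := fun q _ => raiseTot q ∈ _) ?_ (by simp)
      (fun q r _ _ hq hr => by rw [map_add]; exact add_mem hq hr)
      (fun a q _ hq => by rw [map_smul]; exact Submodule.smul_mem _ a hq) ih
    rintro _ ⟨A, hA, rfl⟩
    rw [raiseTot, LinearMap.sum_apply]
    refine Submodule.sum_mem _ fun α _ => ?_
    rw [raise_config]
    split_ifs with h
    · exact zero_mem _
    · refine Submodule.subset_span ⟨_, ?_, rfl⟩
      simp only [Set.mem_ofPred_eq] at hA ⊢
      rw [Finset.card_insert_of_notMem h, hA, add_assoc]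

theorem raiseTot_pow_hsPoly : (raiseTot ^ (N + 1)) (hsPoly N) = 0 := by
  have h : hsPoly N ∈ Submodule.span ℂ (config '' {A : Finset (Fin N) | A.card = N / 2}) :=
    Submodule.sum_mem _ fun A hA => Submodule.smul_mem _ _
      (Submodule.subset_span ⟨A, Finset.mem_powersetCard_univ.mp hA, rfl⟩)
  have h1 := raiseTot_pow_mem_span (N + 1) (N / 2) h
  -- More than `N` up spins are impossible.
  have h2 : {A : Finset (Fin N) | A.card = N / 2 + (N + 1)} = ∅ := by
    ext A
    have := card_finset_fin_le A
    simp only [Set.mem_ofPred_eq, Set.mem_empty_iff_false, iff_false]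
    omega
  rw [h2, Set.image_empty, Submodule.span_empty, Submodule.mem_bot] at h1
  exact h1

/-- A vector of weight zero killed by the total lowering operator and by a power of the total
raising operator is killed by the total raising operator. -/
theorem raiseTot_eq_zero {p : Fock N} (hw : ∑ β, weight β p = 0) (hl : ∑ β, lower β p = 0)
    {m : ℕ} (hm : (raiseTot ^ m) p = 0) : raiseTot p = 0 := by
  have hweight : ∀ n : ℕ, ∑ β, weight β ((raiseTot ^ n) p) = (2 * n : ℂ) • (raiseTot ^ n) p := by
    intro n
    induction n with
    | zero => simpa using hw
    | succ n ih =>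
      rw [pow_succ', Module.End.mul_apply]
      have h : ∀ β : Fin N, weight β (raiseTot ((raiseTot ^ n) p))
          = raiseTot (weight β ((raiseTot ^ n) p)) + (2 : ℂ) • raise β ((raiseTot ^ n) p) :=
        fun β => by rw [raiseTot_weight]; abel
      simp_rw [h]
      rw [Finset.sum_add_distrib, ← map_sum, ih, map_smul, ← Finset.smul_sum,
        ← LinearMap.sum_apply, ← raiseTot, ← add_smul]
      congr 1
      push_cast
      ring
  have hrec : ∀ n : ℕ, ∑ β, lower β ((raiseTot ^ (n + 1)) p)
      = raiseTot (∑ β, lower β ((raiseTot ^ n) p)) - (2 * n : ℂ) • (raiseTot ^ n) p := by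
    intro n
    have h : ∀ β : Fin N, lower β ((raiseTot ^ (n + 1)) p)
        = raiseTot (lower β ((raiseTot ^ n) p)) - weight β ((raiseTot ^ n) p) :=
      fun β => by rw [raiseTot_lower, pow_succ', Module.End.mul_apply]; abel
    simp_rw [h]
    rw [Finset.sum_sub_distrib, ← map_sum, hweight]
  -- The usual sl₂ recursion for a lowest weight vector of weight zero.
  have hlower : ∀ n : ℕ, ∑ β, lower β ((raiseTot ^ (n + 1)) p)
      = -((n * (n + 1) : ℂ) • (raiseTot ^ n) p) := by
    intro n
    induction n with
    | zero => rw [hrec]; simp [hl]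
    | succ n ih =>
      rw [hrec, ih, map_neg, map_smul, ← Module.End.mul_apply, ← pow_succ']
      push_cast
      module
  -- The coefficient (n+1)(n+2) is nonzero, so vanishing descends one power at a time; the descent
  -- stops at the first power, because the next coefficient would be zero.
  have hstep : ∀ n : ℕ, (raiseTot ^ (n + 2)) p = 0 → (raiseTot ^ (n + 1)) p = 0 := by
    intro n hn
    have h := hlower (n + 1)
    rw [hn] at h
    simp only [map_zero, Finset.sum_const_zero] at h
    refine (smul_eq_zero.mp (neg_eq_zero.mp h.symm)).resolve_left ?_
    exact_mod_cast (by positivity : (n + 1) * (n + 1 + 1) ≠ 0)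
  have hall : ∀ n : ℕ, (raiseTot ^ (n + 1)) p = 0 → raiseTot p = 0 := by
    intro n
    induction n with
    | zero => intro h; simpa using h
    | succ n ih => exact fun h => ih (hstep n h)
  exact hall m (by rw [pow_succ', Module.End.mul_apply, hm, map_zero])

theorem raiseTot_hsPoly (hN : Even N) (h2 : 2 ≤ N) : raiseTot (hsPoly N) = 0 :=
  raiseTot_eq_zero (sum_weight_hsPoly hN) (sum_lower_hsPoly h2) raiseTot_pow_hsPoly

/-- The part of the total raising operator acting away from the site `α`. -/
def raiseRest (α : Fin N) : Module.End ℂ (Fock N) := ∑ β ∈ Finset.univ.erase α, raise β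

theorem raiseTot_linear {α : Fin N} {u v : Fock N} (hu : IsFreeAt α u) (hv : IsFreeAt α v) :
    raiseTot (X (α, true) * u + X (α, false) * v)
      = X (α, true) * (v + raiseRest α u) + X (α, false) * raiseRest α v := by
  have h : ∀ β ∈ Finset.univ.erase α, raise β (X (α, true) * u + X (α, false) * v)
      = X (α, true) * raise β u + X (α, false) * raise β v := by
    intro β hβ
    have hne := Finset.ne_of_mem_erase hβ
    simp only [raise_apply, map_add, pderiv_mul, IsFreeAt.X hne.symm _ _]
    ring
  rw [raiseTot, LinearMap.sum_apply, ← Finset.add_sum_erase _ _ (Finset.mem_univ α),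
    Finset.sum_congr rfl h, raise_apply, pderiv_false_linear hu hv, raiseRest,
    LinearMap.sum_apply, LinearMap.sum_apply, Finset.sum_add_distrib, ← Finset.mul_sum,
    ← Finset.mul_sum]
  ring

theorem IsFreeAt.raiseRest {α : Fin N} {p : Fock N} (hp : IsFreeAt α p) :
    IsFreeAt α (raiseRest α p) := by
  rw [SpinChain.raiseRest, LinearMap.sum_apply]
  exact IsFreeAt.sum _ fun β hβ => hp.raise (Finset.ne_of_mem_erase hβ)

/-- Because `raiseTot p = 0`, the triple `L`, `Z`, `R` is generated from `L` by the total raising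
operator, as a vector operator requires. With `L = b† v` at `α`, raising gives `Z = a† v - b† h` and
then `R = a† h`: exactly the lowering, weight and raising components of the spin at `α` acting on `g
= a† v + b† h`. -/
theorem exists_linear_fockSpin {α : Fin N} {p : Fock N} (hp : IsLinearAt α p)
    (hr : raiseTot p = 0) (c : Fin N → ℂ)
    (hc : pderiv (α, true) (∑ β ∈ Finset.univ.erase α, c β • lower β p) = 0) :
    ∃ g, IsLinearAt α g ∧ ∀ i,
      ∑ β ∈ Finset.univ.erase α, c β • fockSpin β i p = fockSpin α i g := by
  set L := ∑ β ∈ Finset.univ.erase α, c β • lower β p with hL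
  set Z := ∑ β ∈ Finset.univ.erase α, c β • weight β p with hZ
  set R := ∑ β ∈ Finset.univ.erase α, c β • raise β p with hR
  have hLZ : raiseTot L = Z := by
    simp [hL, hZ, map_sum, raiseTot_lower, hr]
  have hZR : raiseTot Z = -((2 : ℂ) • R) := by
    simp only [hZ, hR, map_sum, map_smul, raiseTot_weight, hr, map_zero, zero_sub, smul_neg,
      Finset.sum_neg_distrib, Finset.smul_sum, smul_comm (2 : ℂ)]
  have hR0 : raiseTot R = 0 := by
    simp [hR, map_sum, raiseTot_raise, hr]
  have hlin : IsLinearAt α L :=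
    IsLinearAt.sum _ fun β hβ => (hp.lower (Finset.ne_of_mem_erase hβ)).smul _
  obtain ⟨u, v, hu, hv, hLuv⟩ := hlin
  rw [hLuv, pderiv_true_linear hu hv] at hc
  subst hc
  obtain ⟨h, hh⟩ : ∃ h, h = -raiseRest α v := ⟨_, rfl⟩
  have hfree : IsFreeAt α h := by
    rw [hh, ← neg_one_smul ℂ]; exact hv.raiseRest.smul _
  have hZ' : Z = X (α, true) * v + X (α, false) * -h := by
    rw [← hLZ, hLuv, raiseTot_linear hu hv, hh]
    simp
  have hnfree : IsFreeAt α (-h) := by rw [← neg_one_smul ℂ]; exact hfree.smul _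
  have hR' : R = X (α, true) * h + X (α, false) * ((1 / 2 : ℂ) • raiseRest α h) := by
    have h1 : R = -((1 / 2 : ℂ) • raiseTot Z) := by rw [hZR]; module
    have h2 : raiseRest α v = -h := by rw [hh, neg_neg]
    rw [h1, hZ', raiseTot_linear hv hnfree, map_neg, h2]
    simp only [mul_add, smul_add, mul_neg, mul_smul_comm]
    module
  -- The triple ends at `R`: the a-part of `raiseTot R = 0` is 3/2 times `raiseRest α h`, one half
  -- from the b-part of `R` and one from its a-part.
  have hrest : raiseRest α h = 0 := by
    have h1 := hR0
    rw [hR', raiseTot_linear hfree (hfree.raiseRest.smul _)] at h1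
    have h2 := congrArg (pderiv (α, true)) h1
    rw [pderiv_true_linear (((hfree.raiseRest).smul _).add hfree.raiseRest)
      ((hfree.raiseRest).smul _).raiseRest, map_zero] at h2
    have h3 : ((3 / 2 : ℂ)) • raiseRest α h = 0 := by rw [← h2]; module
    exact (smul_eq_zero.mp h3).resolve_left (by norm_num)
  rw [hrest, smul_zero, mul_zero, add_zero] at hR'
  rw [mul_zero, zero_add] at hLuv
  refine ⟨X (α, true) * v + X (α, false) * h, ⟨v, h, hv, hfree, rfl⟩, fun i => ?_⟩
  fin_cases i
  · change ∑ β ∈ _, c β • fockSpin β 0 p = fockSpin α 0 _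
    rw [fockSpin_zero_linear hv hfree, ← smul_eq_C_mul, ← hR', ← hLuv, hL, hR,
      ← Finset.sum_add_distrib, Finset.smul_sum]
    refine Finset.sum_congr rfl fun β _ => ?_
    rw [fockSpin_zero, LinearMap.smul_apply, LinearMap.add_apply]
    module
  · change ∑ β ∈ _, c β • fockSpin β 1 p = fockSpin α 1 _
    rw [fockSpin_one_linear hv hfree, ← smul_eq_C_mul, ← hR', ← hLuv, hL, hR,
      ← Finset.sum_sub_distrib, Finset.smul_sum]
    refine Finset.sum_congr rfl fun β _ => ?_
    rw [fockSpin_one, LinearMap.smul_apply, LinearMap.sub_apply]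
    module
  · change ∑ β ∈ _, c β • fockSpin β 2 p = fockSpin α 2 _
    rw [fockSpin_two_linear hv hfree, ← smul_eq_C_mul, sub_eq_add_neg, ← mul_neg, ← hZ', hZ,
      Finset.smul_sum]
    refine Finset.sum_congr rfl fun β _ => ?_
    rw [fockSpin_two, LinearMap.smul_apply]
    module

theorem sum_fockSpin_hsPoly (hN : Even N) (h2 : 2 ≤ N) (i : Fin 3) :
    ∑ β, fockSpin β i (hsPoly N) = 0 := by
  have hl := sum_lower_hsPoly h2
  have hw := sum_weight_hsPoly hN
  have hr := raiseTot_hsPoly hN h2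
  rw [raiseTot, LinearMap.sum_apply] at hr
  fin_cases i
  · change ∑ β, fockSpin β 0 (hsPoly N) = 0
    simp [fockSpin_zero, ← Finset.smul_sum, Finset.sum_add_distrib, hl, hr]
  · change ∑ β, fockSpin β 1 (hsPoly N) = 0
    simp only [fockSpin_one, LinearMap.smul_apply, LinearMap.sub_apply, ← Finset.smul_sum,
      Finset.sum_sub_distrib, hl, hr, sub_zero, smul_zero]
  · change ∑ β, fockSpin β 2 (hsPoly N) = 0
    simp only [fockSpin_two, LinearMap.smul_apply, ← Finset.smul_sum, hw, smul_zero]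

end

section

variable {N : ℕ}

/-! ### Lattice sums of the coefficients -/

theorem sub_one_mul_sum_mul_pow (t : ℂ) (n : ℕ) :
    (t - 1) * ∑ k ∈ Finset.range n, (k : ℂ) * t ^ k
      = n * t ^ n - t * ∑ k ∈ Finset.range n, t ^ k := by
  induction n with
  | zero => simp
  | succ n ih =>
    rw [Finset.sum_range_succ, Finset.sum_range_succ, mul_add, ih]
    push_cast
    ring

theorem sub_one_mul_sum_sq_mul_pow (t : ℂ) (n : ℕ) :
    (t - 1) * ∑ k ∈ Finset.range n, (k : ℂ) ^ 2 * t ^ k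
      = n ^ 2 * t ^ n - 2 * t * ∑ k ∈ Finset.range n, (k : ℂ) * t ^ k
        - t * ∑ k ∈ Finset.range n, t ^ k := by
  induction n with
  | zero => simp
  | succ n ih =>
    rw [Finset.sum_range_succ, Finset.sum_range_succ, Finset.sum_range_succ, mul_add, ih]
    push_cast
    ring

theorem sum_range_cast (n : ℕ) :
    ∑ k ∈ Finset.range n, (k : ℂ) = (n : ℂ) * (n - 1) / 2 := by
  induction n with
  | zero => simp
  | succ n ih => rw [Finset.sum_range_succ, ih]; push_cast; ring

theorem sum_range_cast_sq (n : ℕ) :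
    ∑ k ∈ Finset.range n, (k : ℂ) ^ 2 = (n : ℂ) * (n - 1) * (2 * n - 1) / 6 := by
  induction n with
  | zero => simp
  | succ n ih => rw [Finset.sum_range_succ, ih]; push_cast; ring

/-- The sum over all sites but `β` of a function of the ratio `η_α / η_β` with vanishing
constant Fourier coefficient. -/
theorem sum_erase_sum_ratio_pow (β : Fin N) (a : ℕ → ℂ) (h0 : a 0 = 0) :
    ∑ α ∈ Finset.univ.erase β, ∑ k ∈ Finset.range N, a k * (eta α / eta β) ^ k
      = -∑ k ∈ Finset.range N, a k := by
  have hall : ∑ α : Fin N, ∑ k ∈ Finset.range N, a k * (eta α / eta β) ^ k = 0 := by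
    rw [Finset.sum_comm]
    refine Finset.sum_eq_zero fun k hk => ?_
    rw [← Finset.mul_sum]
    rcases Nat.eq_zero_or_pos k with rfl | hpos
    · rw [h0, zero_mul]
    · simp_rw [div_pow]
      rw [← Finset.sum_div, sum_eta_pow hpos (Finset.mem_range.mp hk), zero_div, mul_zero]
  rw [← Finset.add_sum_erase _ _ (Finset.mem_univ β), div_self (eta_ne_zero β)] at hall
  simp only [one_pow, mul_one] at hall
  rw [eq_neg_iff_add_eq_zero, add_comm, hall]

theorem ratio_facts {α β : Fin N} (h : α ≠ β) :
    (eta α / eta β) ^ N = 1 ∧ eta α / eta β - 1 ≠ 0 ∧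
      ∑ k ∈ Finset.range N, (eta α / eta β) ^ k = 0 := by
  have h1 : (eta α / eta β) ^ N = 1 := by
    rw [div_pow, eta_pow_card α.pos, eta_pow_card α.pos, div_one]
  have h2 : eta α / eta β - 1 ≠ 0 := by
    rw [div_sub_one (eta_ne_zero β)]
    exact div_ne_zero (eta_sub_ne_zero h) (eta_ne_zero β)
  refine ⟨h1, h2, ?_⟩
  rw [geom_sum_eq (sub_ne_zero.mp h2), h1, sub_self, zero_div]

/-- The finite Fourier expansion of 1/(x - 1) at nontrivial `N`-th roots of unity `x`, which reduces
lattice sums to sums of powers of integers. -/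
theorem sum_mul_ratio_pow {α β : Fin N} (h : α ≠ β) :
    ∑ k ∈ Finset.range N, (k : ℂ) * (eta α / eta β) ^ k = N * (eta β / (eta α - eta β)) := by
  obtain ⟨h1, h2, h3⟩ := ratio_facts h
  have h4 := sub_one_mul_sum_mul_pow (eta α / eta β) N
  rw [h1, h3, mul_zero, sub_zero, mul_one] at h4
  have hb := eta_ne_zero β
  have hs := eta_sub_ne_zero h
  rw [eq_comm, ← mul_right_inj' h2, h4]
  field_simp

theorem sum_sq_mul_ratio_pow {α β : Fin N} (h : α ≠ β) :
    ∑ k ∈ Finset.range N, (k : ℂ) ^ 2 * (eta α / eta β) ^ k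
      = (N ^ 2 - 2 * N) * (eta β / (eta α - eta β))
        - 2 * N * (eta β / (eta α - eta β)) ^ 2 := by
  obtain ⟨h1, h2, h3⟩ := ratio_facts h
  have h4 := sub_one_mul_sum_sq_mul_pow (eta α / eta β) N
  rw [h1, h3, mul_zero, sub_zero, mul_one, sum_mul_ratio_pow h] at h4
  have hb := eta_ne_zero β
  have hs := eta_sub_ne_zero h
  rw [← mul_right_inj' h2, h4]
  field_simp
  ring

theorem sum_div_sub (β : Fin N) :
    ∑ α ∈ Finset.univ.erase β, eta β / (eta α - eta β) = -(((N : ℂ) - 1) / 2) := by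
  have hN : (N : ℂ) ≠ 0 := by exact_mod_cast β.pos.ne'
  have h := sum_erase_sum_ratio_pow β (fun k => (k : ℂ)) (by simp)
  rw [Finset.sum_congr rfl fun α hα => sum_mul_ratio_pow (Finset.ne_of_mem_erase hα),
    ← Finset.mul_sum, sum_range_cast] at h
  rw [← mul_right_inj' hN, h]
  ring

theorem sum_div_sub_sq (β : Fin N) :
    ∑ α ∈ Finset.univ.erase β, (eta β / (eta α - eta β)) ^ 2
      = ((N : ℂ) - 1) * (5 - N) / 12 := by
  have hN : (N : ℂ) ≠ 0 := by exact_mod_cast β.pos.ne'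
  have h := sum_erase_sum_ratio_pow β (fun k => (k : ℂ) ^ 2) (by simp)
  rw [Finset.sum_congr rfl fun α hα => sum_sq_mul_ratio_pow (Finset.ne_of_mem_erase hα),
    Finset.sum_sub_distrib, ← Finset.mul_sum, ← Finset.mul_sum, sum_range_cast_sq,
    sum_div_sub] at h
  rw [← mul_right_inj' hN]
  linear_combination (-1 / 2 : ℂ) * h

theorem card_erase_cast (β : Fin N) : (((Finset.univ.erase β).card : ℕ) : ℂ) = N - 1 := by
  rw [Finset.card_erase_of_mem (Finset.mem_univ β), Finset.card_univ, Fintype.card_fin,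
    Nat.cast_pred β.pos]

theorem sum_add_div_sub (β : Fin N) :
    ∑ α ∈ Finset.univ.erase β, (eta α + eta β) / (eta α - eta β) = 0 := by
  have h : ∀ α ∈ Finset.univ.erase β,
      (eta α + eta β) / (eta α - eta β) = 1 + 2 * (eta β / (eta α - eta β)) := by
    intro α hα
    have := eta_sub_ne_zero (Finset.ne_of_mem_erase hα)
    field_simp
    ring
  rw [Finset.sum_congr rfl h, Finset.sum_add_distrib, ← Finset.mul_sum, sum_div_sub,
    Finset.sum_const, nsmul_eq_mul, card_erase_cast]
  ring

/-- `1 / (conj η_α - conj η_β)`. -/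
def conjCoeff (α β : Fin N) : ℂ := 1 / (starRingEnd ℂ (eta α) - starRingEnd ℂ (eta β))

/-- `1 / (η_α - η_β)`. -/
def coeff (α β : Fin N) : ℂ := 1 / (eta α - eta β)

theorem omega_eq (α β γ : Fin N) : omega α β γ = conjCoeff α β * coeff α γ := by
  rw [omega, conjCoeff, coeff, one_div_mul_one_div]

theorem omega_self_left (α γ : Fin N) : omega α α γ = 0 := by simp [omega]

theorem omega_self_right (α β : Fin N) : omega α β α = 0 := by simp [omega]

theorem omega_self (α β : Fin N) : omega α β β = invDistSq α β := by
  rw [omega, invDistSq, ← map_sub, mul_comm, Complex.mul_conj, Complex.normSq_eq_norm_sq]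
  push_cast
  rfl

theorem invDistSq_self (α : Fin N) : invDistSq α α = 0 := by simp [invDistSq]

theorem invDistSq_comm (α β : Fin N) : invDistSq α β = invDistSq β α := by
  rw [invDistSq, invDistSq, norm_sub_rev]

theorem conj_sub_conj (α β : Fin N) :
    starRingEnd ℂ (eta α) - starRingEnd ℂ (eta β) = -(eta α - eta β) / (eta α * eta β) := by
  rw [conj_eta, conj_eta]
  have := eta_ne_zero α
  have := eta_ne_zero β
  field_simp
  ring

theorem conjCoeff_eq {α β : Fin N} (h : α ≠ β) :
    conjCoeff α β = -eta α ^ 2 * coeff α β + eta α := by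
  have := eta_ne_zero α
  have := eta_ne_zero β
  have := eta_sub_ne_zero h
  rw [conjCoeff, coeff, conj_sub_conj]
  field_simp
  ring

theorem invDistSq_eq {α β : Fin N} (h : α ≠ β) :
    invDistSq α β = -(eta β / (eta α - eta β) + (eta β / (eta α - eta β)) ^ 2) := by
  have := eta_ne_zero α
  have := eta_ne_zero β
  have := eta_sub_ne_zero h
  rw [← omega_self, omega, conj_sub_conj]
  field_simp
  ring

theorem sum_invDistSq (β : Fin N) :
    ∑ α, invDistSq α β = ((N : ℂ) ^ 2 - 1) / 12 := by
  rw [← Finset.add_sum_erase _ _ (Finset.mem_univ β), invDistSq_self, zero_add,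
    Finset.sum_congr rfl fun α hα => invDistSq_eq (Finset.ne_of_mem_erase hα),
    Finset.sum_neg_distrib, Finset.sum_add_distrib, sum_div_sub, sum_div_sub_sq]
  ring

/-- By partial fractions in η_α, the two full sums cancel since `sum_div_sub` does not depend on the
site; what remains comes from the excluded terms. -/
theorem sum_omega {β γ : Fin N} (h : β ≠ γ) :
    ∑ α, omega α β γ = -(eta β * (eta β + eta γ)) / (eta β - eta γ) ^ 2 := by
  have hbc := eta_sub_ne_zero h
  have hcb := eta_sub_ne_zero h.symm
  have hpart : ∀ α ∈ (Finset.univ.erase β).erase γ,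
      omega α β γ = -(eta β / (eta β - eta γ))
        * ((1 + eta β / (eta α - eta β)) - (1 + eta γ / (eta α - eta γ))) := by
    intro α hα
    have hγ := eta_sub_ne_zero (Finset.ne_of_mem_erase hα)
    have hβ := eta_sub_ne_zero (Finset.ne_of_mem_erase (Finset.mem_of_mem_erase hα))
    have := eta_ne_zero α
    have := eta_ne_zero β
    rw [omega, conj_sub_conj]
    field_simp
    ring
  have h1 := sum_div_sub β
  have h2 := sum_div_sub γ
  rw [← Finset.add_sum_erase _ _ (Finset.mem_erase.mpr ⟨h.symm, Finset.mem_univ γ⟩)] at h1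
  rw [← Finset.add_sum_erase _ _ (Finset.mem_erase.mpr ⟨h, Finset.mem_univ β⟩),
    Finset.erase_right_comm] at h2
  rw [← Finset.add_sum_erase _ _ (Finset.mem_univ β), omega_self_left, zero_add,
    ← Finset.add_sum_erase _ _ (Finset.mem_erase.mpr ⟨h.symm, Finset.mem_univ γ⟩),
    omega_self_right, zero_add, Finset.sum_congr rfl hpart, ← Finset.mul_sum,
    Finset.sum_sub_distrib, Finset.sum_add_distrib, Finset.sum_add_distrib,
    eq_sub_of_add_eq' h1, eq_sub_of_add_eq' h2]
  have e : eta γ - eta β = -(eta β - eta γ) := by ring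
  rw [e]
  field_simp
  ring

/-- The symmetrised sum suffices, as it multiplies the symmetric S_β·S_γ. On the diagonal, (N²+5)/6
is 2(N²-1)/12 plus 1 to offset the -1. -/
theorem sum_omega_add_sum_omega (β γ : Fin N) :
    ∑ α, omega α β γ + ∑ α, omega α γ β
      = 4 * invDistSq β γ - 1 + if β = γ then ((N : ℂ) ^ 2 + 5) / 6 else 0 := by
  split_ifs with h
  · subst h
    simp_rw [omega_self]
    rw [sum_invDistSq, invDistSq_self]
    ring
  · have hbc := eta_sub_ne_zero h
    have e : eta γ - eta β = -(eta β - eta γ) := by ring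
    rw [sum_omega h, sum_omega (Ne.symm h), invDistSq_eq h, e]
    field_simp
    ring

end

section

/-! ### Operator identities for a chain of spins -/

section Chain

variable {N : ℕ} {R : Type*} [Ring R] [Algebra ℂ R]

/-- Mutually commuting spins `S α` of quantum number `s`. -/
structure IsSpinChain (s : ℂ) (S : Fin N → Fin 3 → R) : Prop where
  spin_comm : ∀ α i,
    S α (i + 1) * S α (i + 2) - S α (i + 2) * S α (i + 1) = Complex.I • S α i
  casimir : ∀ α, dot (S α) (S α) = (s * (s + 1)) • (1 : R)
  commute : ∀ α β, α ≠ β → ∀ i j, Commute (S α i) (S β j)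

/-- `∑_{β ≠ α} c_β S_β`. -/
def vecSum (S : Fin N → Fin 3 → R) (α : Fin N) (c : Fin N → ℂ) (i : Fin 3) : R :=
  ∑ β ∈ Finset.univ.erase α, c β • S β i

/-- The operators `D_α` of a chain of spins `S`. -/
def chainD (s : ℂ) (S : Fin N → Fin 3 → R) (α : Fin N) (i : Fin 3) : R :=
  (1 / 2 : ℂ) • ∑ β ∈ Finset.univ.erase α, ((eta α + eta β) / (eta α - eta β)) •
    (Complex.I • cross (S α) (S β) i + (s + 1) • S β i
      - (1 / (s + 1)) • (S α i * dot (S α) (S β)))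

/-- The operator `Λ` of a chain of spins `S`. -/
def chainLambda (s : ℂ) (S : Fin N → Fin 3 → R) (i : Fin 3) : R :=
  (1 / 2 : ℂ) • ∑ α : Fin N, ∑ β ∈ Finset.univ.erase α,
    ((eta α + eta β) / (eta α - eta β)) •
      (Complex.I • cross (S α) (S β) i - (1 / (s + 1)) • (S α i * dot (S α) (S β)))

/-- The five-spin term of a chain of spins `S`. -/
def chainFive (S : Fin N → Fin 3 → R) (α β γ : Fin N) (i : Fin 3) : R :=
  dot (S α) (S β) * S α i * dot (S α) (S γ) + dot (S α) (S γ) * S α i * dot (S α) (S β)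

/-- The three-spin term of a chain of spins `S`. -/
def chainThree (s : ℂ) (S : Fin N → Fin 3 → R) (α β γ : Fin N) (i : Fin 3) : R :=
  (2 * (s + 2)) • (S α i * dot (S β) (S γ)) - S β i * dot (S α) (S γ)
    - dot (S α) (S β) * S γ i

/-- The operators `A_α` of a chain of spins `S`. -/
def chainA (s : ℂ) (S : Fin N → Fin 3 → R) (α : Fin N) (i : Fin 3) : R :=
  (∑ β ∈ Finset.univ.erase α, invDistSq α β •
    (S α i * dot (S α) (S β) + dot (S α) (S β) * S α i + (2 * (s + 1)) • S β i))
  + ∑ β ∈ Finset.univ.erase α, ∑ γ ∈ Finset.univ.erase α, omega α β γ •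
      (-((1 / (s + 1)) • chainFive S α β γ i) + chainThree s S α β γ i)

/-- The operator `Υ` of a chain of spins `S`. -/
def chainUpsilon (s : ℂ) (S : Fin N → Fin 3 → R) (i : Fin 3) : R :=
  -((1 / (s + 1)) • ∑ α : Fin N, ∑ β ∈ Finset.univ.erase α, ∑ γ ∈ Finset.univ.erase α,
      omega α β γ • chainFive S α β γ i)
  + ∑ α : Fin N, ∑ β ∈ Finset.univ.erase α, ∑ γ ∈ (Finset.univ.erase α).erase β,
      omega α β γ • chainThree s S α β γ i

/-- The bracket in the Hamiltonian of a chain of spins `S`. -/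
def chainH (s : ℂ) (S : Fin N → Fin 3 → R) : R :=
  (∑ α : Fin N, ∑ β ∈ Finset.univ.erase α, invDistSq α β • dot (S α) (S β))
    - (1 / (2 * (s + 1) * (2 * s + 3))) •
      ∑ α : Fin N, ∑ β ∈ Finset.univ.erase α, ∑ γ ∈ Finset.univ.erase α,
        omega α β γ • (dot (S α) (S β) * dot (S α) (S γ) + dot (S α) (S γ) * dot (S α) (S β))

theorem sum_smul_mul_sum_smul {ι κ : Type*} (s : Finset ι)
    (t : Finset κ) (c : ι → ℂ) (d : κ → ℂ) (f : ι → R) (g : κ → R) :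
    (∑ i ∈ s, c i • f i) * ∑ j ∈ t, d j • g j
      = ∑ i ∈ s, ∑ j ∈ t, (c i * d j) • (f i * g j) := by
  rw [Finset.sum_mul_sum]
  refine Finset.sum_congr rfl fun i _ => Finset.sum_congr rfl fun j _ => ?_
  rw [smul_mul_smul_comm]

theorem sum_smul_mul_mul_sum_smul {ι κ : Type*} (s : Finset ι)
    (t : Finset κ) (c : ι → ℂ) (d : κ → ℂ) (f : ι → R) (x : R) (g : κ → R) :
    (∑ i ∈ s, c i • f i) * x * ∑ j ∈ t, d j • g j
      = ∑ i ∈ s, ∑ j ∈ t, (c i * d j) • (f i * x * g j) := by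
  simp only [Finset.sum_mul _ _ x, smul_mul_assoc _ _ x, sum_smul_mul_sum_smul]

theorem dot_spin_vecSum (S : Fin N → Fin 3 → R) (α : Fin N) (c : Fin N → ℂ) :
    dot (S α) (vecSum S α c) = ∑ β ∈ Finset.univ.erase α, c β • dot (S α) (S β) := by
  simp only [dot, vecSum, Finset.mul_sum, mul_smul_comm, Finset.smul_sum]
  rw [Finset.sum_comm]

theorem dot_vecSum_vecSum (S : Fin N → Fin 3 → R) (α : Fin N) (c d : Fin N → ℂ) :
    dot (vecSum S α c) (vecSum S α d)
      = ∑ β ∈ Finset.univ.erase α, ∑ γ ∈ Finset.univ.erase α,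
        (c β * d γ) • dot (S β) (S γ) := by
  simp only [dot, vecSum, sum_smul_mul_sum_smul, Finset.smul_sum]
  rw [Finset.sum_comm]
  exact Finset.sum_congr rfl fun β _ => Finset.sum_comm

theorem chainD_eq_topProj (s : ℂ) (S : Fin N → Fin 3 → R) (α : Fin N) (i : Fin 3) :
    chainD s S α i = (1 / 2 : ℂ) • topProj s (S α)
      (vecSum S α fun β => (eta α + eta β) / (eta α - eta β)) i := by
  rw [chainD, topProj, dot_spin_vecSum]
  congr 1
  simp only [cross, vecSum, Finset.mul_sum, mul_smul_comm,
    ← Finset.sum_sub_distrib, ← Finset.sum_add_distrib, Finset.smul_sum]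
  refine Finset.sum_congr rfl fun β _ => ?_
  module

theorem chainA_eq_quad (s : ℂ) (S : Fin N → Fin 3 → R) (α : Fin N) (i : Fin 3) :
    chainA s S α i = IsSpinPair.quad s (S α) (vecSum S α (conjCoeff α))
      (vecSum S α (coeff α)) (vecSum S α (invDistSq α)) i := by
  rw [chainA, IsSpinPair.quad]
  congr 1
  · simp only [dot_spin_vecSum, vecSum, Finset.mul_sum, Finset.sum_mul, mul_smul_comm,
      smul_mul_assoc, ← Finset.sum_add_distrib, Finset.smul_sum]
    refine Finset.sum_congr rfl fun β _ => ?_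
    module
  · have h2 : dot (S α) (vecSum S α (coeff α)) * S α i
        * dot (S α) (vecSum S α (conjCoeff α)) = ∑ β ∈ Finset.univ.erase α,
          ∑ γ ∈ Finset.univ.erase α,
            omega α β γ • (dot (S α) (S γ) * S α i * dot (S α) (S β)) := by
      simp only [dot_spin_vecSum, sum_smul_mul_mul_sum_smul, omega_eq]
      rw [Finset.sum_comm]
      simp only [mul_comm (coeff _ _)]
    rw [h2]
    simp only [dot_spin_vecSum, dot_vecSum_vecSum, sum_smul_mul_mul_sum_smul]
    simp only [vecSum, sum_smul_mul_sum_smul, ← omega_eq]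
    simp only [Finset.mul_sum, mul_smul_comm,
      ← Finset.sum_sub_distrib, ← Finset.sum_add_distrib, ← Finset.sum_neg_distrib,
      Finset.smul_sum]
    refine Finset.sum_congr rfl fun β _ => Finset.sum_congr rfl fun γ _ => ?_
    rw [chainFive, chainThree]
    module

theorem sum_erase_smul_eq (α : Fin N) (c : Fin N → ℂ) (f : Fin N → R) (h : c α = 0) :
    ∑ β ∈ Finset.univ.erase α, c β • f β = ∑ β, c β • f β :=
  Finset.sum_erase _ (by rw [h, zero_smul])

theorem sum_erase_sum_erase_omega (α : Fin N) (f : Fin N → Fin N → R) :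
    ∑ β ∈ Finset.univ.erase α, ∑ γ ∈ Finset.univ.erase α, omega α β γ • f β γ
      = ∑ β, ∑ γ, omega α β γ • f β γ := by
  rw [Finset.sum_erase _ (by simp [omega_self_left])]
  exact Finset.sum_congr rfl fun β _ => sum_erase_smul_eq α _ _ (omega_self_right α β)

namespace IsSpinChain

variable {s : ℂ} {S : Fin N → Fin 3 → R}

theorem dot_comm (h : IsSpinChain s S) (α β : Fin N) : dot (S α) (S β) = dot (S β) (S α) := by
  by_cases hαβ : α = β
  · rw [hαβ]
  · exact Finset.sum_congr rfl fun i _ => (h.commute α β hαβ i i).eq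

/-- Spins on different sites commute, so only the diagonal of the double sum survives. -/
theorem vecSum_bracket (h : IsSpinChain s S) (α : Fin N) (c d : Fin N → ℂ) (i j : Fin 3) :
    vecSum S α c i * vecSum S α d j - vecSum S α d j * vecSum S α c i
      = ∑ β ∈ Finset.univ.erase α, (c β * d β) • (S β i * S β j - S β j * S β i) := by
  rw [vecSum, vecSum, sum_smul_mul_sum_smul, sum_smul_mul_sum_smul]
  rw [Finset.sum_comm (f := fun γ β => (d γ * c β) • (S γ j * S β i)), ← Finset.sum_sub_distrib]
  refine Finset.sum_congr rfl fun β hβ => ?_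
  rw [← Finset.sum_sub_distrib, Finset.sum_eq_single_of_mem β hβ]
  · module
  · intro γ _ hγ
    rw [(h.commute γ β hγ j i).eq, mul_comm (d γ), sub_self]

theorem commute_vecSum (h : IsSpinChain s S) (α : Fin N) (c : Fin N → ℂ) (i j : Fin 3) :
    Commute (S α i) (vecSum S α c j) :=
  Commute.sum_right _ _ _ fun β hβ =>
    (h.commute α β (Finset.ne_of_mem_erase hβ).symm i j).smul_right _

theorem isSpinPair (h : IsSpinChain s S) (α : Fin N) :
    IsSpinPair s (S α) (vecSum S α (conjCoeff α)) (vecSum S α (coeff α))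
      (vecSum S α (invDistSq α)) where
  spin_comm := h.spin_comm α
  casimir := h.casimir α
  commute_left := h.commute_vecSum α _
  commute_right := h.commute_vecSum α _
  commute_bracket := h.commute_vecSum α _
  commute_same i := by
    refine sub_eq_zero.mp ?_
    rw [h.vecSum_bracket]
    simp
  bracket_pos i := by
    rw [h.vecSum_bracket, vecSum, Finset.smul_sum]
    refine Finset.sum_congr rfl fun β _ => ?_
    rw [h.spin_comm, ← omega_eq, omega_self, smul_comm]
  bracket_neg i := by
    rw [h.vecSum_bracket, vecSum, Finset.smul_sum, ← Finset.sum_neg_distrib]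
    refine Finset.sum_congr rfl fun β _ => ?_
    rw [← neg_sub, h.spin_comm, ← omega_eq, omega_self, smul_neg, smul_comm]

end IsSpinChain

/-! ### Sum rules over the sites. -/

theorem sum_chainD (s : ℂ) (S : Fin N → Fin 3 → R) (i : Fin 3) :
    ∑ α, chainD s S α i = chainLambda s S i := by
  -- For fixed `β`, the coefficients sum to zero over `α`.
  have h0 : ∑ α, ∑ β ∈ Finset.univ.erase α,
      ((eta α + eta β) / (eta α - eta β)) • S β i = 0 := by
    rw [Finset.sum_congr rfl fun α _ => sum_erase_smul_eq (R := R) α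
      (fun β => (eta α + eta β) / (eta α - eta β)) _ (by simp), Finset.sum_comm]
    refine Finset.sum_eq_zero fun β _ => ?_
    rw [← Finset.sum_smul, ← Finset.sum_erase (a := β) _ (by simp), sum_add_div_sub, zero_smul]
  have h1 : ∀ α, chainD s S α i = (1 / 2 : ℂ) • ∑ β ∈ Finset.univ.erase α,
      ((eta α + eta β) / (eta α - eta β)) •
        (Complex.I • cross (S α) (S β) i - (1 / (s + 1)) • (S α i * dot (S α) (S β)))
      + (1 / 2 * (s + 1)) • ∑ β ∈ Finset.univ.erase α,
        ((eta α + eta β) / (eta α - eta β)) • S β i := by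
    intro α
    rw [chainD, Finset.smul_sum, Finset.smul_sum, Finset.smul_sum, ← Finset.sum_add_distrib]
    refine Finset.sum_congr rfl fun β _ => ?_
    module
  simp only [h1]
  rw [Finset.sum_add_distrib, ← Finset.smul_sum, ← Finset.smul_sum, h0, smul_zero, add_zero,
    chainLambda]

namespace IsSpinChain

variable {s : ℂ} {S : Fin N → Fin 3 → R}

theorem sum_chainA (h : IsSpinChain s S) (i : Fin 3) :
    ∑ α, chainA s S α i
      = chainUpsilon s S i + ((s + 1) ^ 3 * (((N : ℂ) ^ 2 - 1) / 6)) • ∑ α, S α i := by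
  -- The terms with `β = γ` join the single sum. Their operator parts are antisymmetric in `α`, `β`
  -- and cancel; the linear terms leave (2(s+1) + 2s(s+1)(s+2)) (N²-1)/12 = (s+1)³ (N²-1)/6.
  have hdiag : ∑ α, ∑ β ∈ Finset.univ.erase α, invDistSq α β •
      (S α i * dot (S α) (S β) + dot (S α) (S β) * S α i + (2 * (s + 1)) • S β i
        + chainThree s S α β β i)
      = ((s + 1) ^ 3 * (((N : ℂ) ^ 2 - 1) / 6)) • ∑ α, S α i := by
    set g : Fin N → Fin N → R := fun α β => S α i * dot (S α) (S β) + dot (S α) (S β) * S α i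
      with hg
    have h1 : ∀ α β, S α i * dot (S α) (S β) + dot (S α) (S β) * S α i + (2 * (s + 1)) • S β i
        + chainThree s S α β β i
        = g α β - g β α + ((2 * (s + 1)) • S β i + (2 * (s + 2) * (s * (s + 1))) • S α i) := by
      intro α β
      simp only [chainThree, h.casimir, hg, h.dot_comm β α, mul_smul_comm, mul_one]
      module
    have h2 : ∑ α, ∑ β, invDistSq α β • (g α β - g β α) = 0 := by
      simp only [smul_sub, Finset.sum_sub_distrib]
      rw [sub_eq_zero, Finset.sum_comm]
      simp only [invDistSq_comm]
    have h3 : ∑ α, ∑ β, invDistSq α β • S β i = (((N : ℂ) ^ 2 - 1) / 12) • ∑ α, S α i := by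
      rw [Finset.sum_comm, Finset.smul_sum]
      exact Finset.sum_congr rfl fun β _ => by rw [← Finset.sum_smul, sum_invDistSq]
    have h4 : ∑ α, ∑ β, invDistSq α β • S α i = (((N : ℂ) ^ 2 - 1) / 12) • ∑ α, S α i := by
      rw [Finset.smul_sum]
      refine Finset.sum_congr rfl fun β _ => ?_
      rw [← Finset.sum_smul, ← sum_invDistSq β]
      simp only [invDistSq_comm β]
    rw [Finset.sum_congr rfl fun α _ => sum_erase_smul_eq α (invDistSq α) _ (invDistSq_self α)]
    simp only [h1]
    simp only [smul_add, Finset.sum_add_distrib, h2, smul_comm (invDistSq _ _) (_ : ℂ) (_ : R),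
      ← Finset.smul_sum, h3, h4]
    module
  have hsplit : ∀ α, chainA s S α i
      = -((1 / (s + 1)) • ∑ β ∈ Finset.univ.erase α, ∑ γ ∈ Finset.univ.erase α,
          omega α β γ • chainFive S α β γ i)
        + ∑ β ∈ Finset.univ.erase α, ∑ γ ∈ (Finset.univ.erase α).erase β,
          omega α β γ • chainThree s S α β γ i
        + ∑ β ∈ Finset.univ.erase α, invDistSq α β •
          (S α i * dot (S α) (S β) + dot (S α) (S β) * S α i + (2 * (s + 1)) • S β i
            + chainThree s S α β β i) := by
    intro α
    rw [chainA, Finset.smul_sum, ← Finset.sum_neg_distrib, ← Finset.sum_add_distrib,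
      ← Finset.sum_add_distrib, ← Finset.sum_add_distrib]
    refine Finset.sum_congr rfl fun β hβ => ?_
    rw [smul_add _ _ (chainThree s S α β β i), ← omega_self α β]
    have e : ∀ γ, omega α β γ • (-((1 / (s + 1)) • chainFive S α β γ i) + chainThree s S α β γ i)
        = -((1 / (s + 1)) • omega α β γ • chainFive S α β γ i)
          + omega α β γ • chainThree s S α β γ i := fun γ => by module
    simp only [e, Finset.sum_add_distrib]
    rw [← Finset.add_sum_erase _ (fun γ => omega α β γ • chainThree s S α β γ i) hβ,
      Finset.smul_sum, ← Finset.sum_neg_distrib]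
    abel
  simp only [hsplit]
  rw [Finset.sum_add_distrib, hdiag, Finset.sum_add_distrib, Finset.sum_neg_distrib,
    ← Finset.smul_sum, chainUpsilon]

theorem sum_omega_dot (h : IsSpinChain s S) :
    ∑ α, ∑ β ∈ Finset.univ.erase α, ∑ γ ∈ Finset.univ.erase α, omega α β γ • dot (S β) (S γ)
      = (2 : ℂ) • (∑ α, ∑ β ∈ Finset.univ.erase α, invDistSq α β • dot (S α) (S β))
        - (1 / 2 : ℂ) • dot (fun i => ∑ α, S α i) (fun i => ∑ α, S α i)
        + ((N : ℂ) * ((N : ℂ) ^ 2 + 5) / 12 * (s * (s + 1))) • (1 : R) := by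
  have htot : dot (fun i => ∑ α, S α i) (fun i => ∑ α, S α i)
      = ∑ β, ∑ γ, dot (S β) (S γ) := by
    simp only [dot, Finset.sum_mul_sum]
    rw [Finset.sum_comm]
    exact Finset.sum_congr rfl fun β _ => Finset.sum_comm
  have h1 : ∑ α, ∑ β ∈ Finset.univ.erase α, ∑ γ ∈ Finset.univ.erase α,
      omega α β γ • dot (S β) (S γ) = ∑ β, ∑ γ, (∑ α, omega α β γ) • dot (S β) (S γ) := by
    simp only [sum_erase_sum_erase_omega, Finset.sum_smul]
    rw [Finset.sum_comm]
    exact Finset.sum_congr rfl fun β _ => Finset.sum_comm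
  have h2 : ∑ β, ∑ γ, (∑ α, omega α β γ) • dot (S β) (S γ)
      = ∑ β, ∑ γ, (∑ α, omega α γ β) • dot (S β) (S γ) := by
    rw [Finset.sum_comm]
    exact Finset.sum_congr rfl fun β _ => Finset.sum_congr rfl fun γ _ => by rw [h.dot_comm]
  have h3 : ∀ β, ∑ γ, (∑ α, omega α β γ) • dot (S β) (S γ)
        + ∑ γ, (∑ α, omega α γ β) • dot (S β) (S γ)
      = (4 : ℂ) • (∑ γ, invDistSq β γ • dot (S β) (S γ)) - ∑ γ, dot (S β) (S γ)
        + (((N : ℂ) ^ 2 + 5) / 6 * (s * (s + 1))) • (1 : R) := by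
    intro β
    have e : ∑ γ, (if β = γ then ((N : ℂ) ^ 2 + 5) / 6 else 0) • dot (S β) (S γ)
        = (((N : ℂ) ^ 2 + 5) / 6 * (s * (s + 1))) • (1 : R) := by
      simp only [ite_smul, zero_smul, Finset.sum_ite_eq, Finset.mem_univ, if_true, h.casimir,
        smul_smul]
    rw [← e, Finset.smul_sum, ← Finset.sum_sub_distrib, ← Finset.sum_add_distrib,
      ← Finset.sum_add_distrib]
    refine Finset.sum_congr rfl fun γ _ => ?_
    rw [← add_smul, sum_omega_add_sum_omega]
    module
  have h4 : (2 : ℂ) • ∑ β, ∑ γ, (∑ α, omega α β γ) • dot (S β) (S γ)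
      = (4 : ℂ) • (∑ α, ∑ β, invDistSq α β • dot (S α) (S β)) - ∑ α, ∑ β, dot (S α) (S β)
        + ((N : ℂ) * (((N : ℂ) ^ 2 + 5) / 6 * (s * (s + 1)))) • (1 : R) := by
    rw [two_smul]
    -- One of the two copies gets `β` and `γ` exchanged, so that only the symmetrised coefficient
    -- enters.
    nth_rewrite 2 [h2]
    rw [← Finset.sum_add_distrib, Finset.sum_congr rfl fun β _ => h3 β, Finset.sum_add_distrib, Finset.sum_sub_distrib, ← Finset.smul_sum, Finset.sum_const,
      Finset.card_univ, Fintype.card_fin, ← Nat.cast_smul_eq_nsmul ℂ, smul_smul]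
  rw [h1, htot, Finset.sum_congr rfl fun α _ =>
    sum_erase_smul_eq α (invDistSq α) _ (invDistSq_self α)]
  calc _ = (1 / 2 : ℂ) • ((2 : ℂ) • ∑ β, ∑ γ, (∑ α, omega α β γ) • dot (S β) (S γ)) := by module
    _ = _ := by rw [h4]; module

/-- The two-spin terms combine with weight (1 + 2(s+1))/(2s+3) = 1, and the total-spin term added on
the left cancels the one produced by `sum_omega_dot`. -/
theorem sum_dot_chainA (h : IsSpinChain s S) (hs0 : s ≠ 0) (hs1 : s + 1 ≠ 0) (hs2 : s + 2 ≠ 0)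
    (hs3 : 2 * s + 3 ≠ 0) :
    (1 / (2 * s * (s + 2) * (2 * s + 3))) • (∑ α, dot (S α) (chainA s S α))
        + ((s + 1) / (2 * (2 * s + 3))) • dot (fun i => ∑ α, S α i) (fun i => ∑ α, S α i)
      = chainH s S
        + (s * (s + 1) ^ 2 / (2 * s + 3) * ((N : ℂ) * ((N : ℂ) ^ 2 + 5) / 12)) • (1 : R) := by
  have hα : ∀ α, dot (S α) (chainA s S α)
      = (2 * s * (s + 2)) • ∑ β ∈ Finset.univ.erase α, invDistSq α β • dot (S α) (S β)
        - (s * (s + 2) / (s + 1)) • ∑ β ∈ Finset.univ.erase α, ∑ γ ∈ Finset.univ.erase α,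
          omega α β γ • (dot (S α) (S β) * dot (S α) (S γ) + dot (S α) (S γ) * dot (S α) (S β))
        + (2 * s * (s + 1) * (s + 2)) • ∑ β ∈ Finset.univ.erase α,
          ∑ γ ∈ Finset.univ.erase α, omega α β γ • dot (S β) (S γ) := by
    intro α
    rw [funext (chainA_eq_quad s S α), (h.isSpinPair α).dot_quad hs1, dot_spin_vecSum,
      dot_spin_vecSum, dot_spin_vecSum, dot_vecSum_vecSum, sum_smul_mul_sum_smul,
      sum_smul_mul_sum_smul]
    rw [Finset.sum_comm (f := fun γ β => (coeff α γ * conjCoeff α β) •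
      (dot (S α) (S γ) * dot (S α) (S β)))]
    simp only [mul_comm (coeff _ _), ← omega_eq, smul_add, Finset.sum_add_distrib]
  simp only [hα, Finset.sum_add_distrib, Finset.sum_sub_distrib, ← Finset.smul_sum,
    h.sum_omega_dot, chainH]
  match_scalars <;> field_simp <;> ring

end IsSpinChain

end Chain

end

section

variable {N k : ℕ}

/-! ### Annihilation of the ground state -/

theorem coe_spin (α : Fin N) (i : Fin 3) (p : SpinSpace N k) :
    ((spin α i p : SpinSpace N k) : Fock N) = fockSpin α i p := rfl

/-- The boson number is `k = 2s` on the chain, and k(k+2)/4 = s(s+1). -/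
theorem spinDot_self (α : Fin N) :
    spinDot α α = (qn k * (qn k + 1)) • (1 : Module.End ℂ (SpinSpace N k)) := by
  refine LinearMap.ext fun p => Subtype.ext ?_
  have h := LinearMap.congr_fun (dot_fockSpin α) p.1
  have hp := mem_spinSpace.mp p.2 α
  simp only [dot, LinearMap.sum_apply, Module.End.mul_apply, LinearMap.smul_apply,
    LinearMap.add_apply, hp, map_smul] at h
  simp only [spinDot, dot, LinearMap.sum_apply, Module.End.mul_apply, LinearMap.smul_apply,
    Submodule.coe_sum, coe_spin, h, Module.End.one_apply, Submodule.coe_smul, qn]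
  module

theorem isSpinChain_spin : IsSpinChain (qn k) (spin (N := N) (k := k)) where
  spin_comm α i := LinearMap.ext fun p =>
    Subtype.ext (LinearMap.congr_fun (fockSpin_comm α i) p.1)
  casimir := spinDot_self
  commute _ _ h i j := LinearMap.ext fun p =>
    Subtype.ext (LinearMap.congr_fun (commute_fockSpin h i j).eq p.1)

/-- The weighted sums `∑_{β ≠ α} c_β S_β` act on the Haldane–Shastry state like the spin at `α` on
some vector with one boson at `α`. -/
def ActsLocally (α : Fin N) (c : Fin N → ℂ) : Prop :=
  ∃ g, IsLinearAt α g ∧ ∀ i,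
    ∑ β ∈ Finset.univ.erase α, c β • fockSpin β i (hsPoly N) = fockSpin α i g

theorem ActsLocally.combination {α : Fin N} {c d e : Fin N → ℂ} (hc : ActsLocally α c)
    (hd : ActsLocally α d) (a b : ℂ) (he : ∀ β, β ≠ α → e β = a * c β + b * d β) :
    ActsLocally α e := by
  obtain ⟨g, hg, hgc⟩ := hc
  obtain ⟨h, hh, hhd⟩ := hd
  refine ⟨a • g + b • h, (hg.smul a).add (hh.smul b), fun i => ?_⟩
  rw [map_add, map_smul, map_smul, ← hgc, ← hhd, Finset.smul_sum, Finset.smul_sum,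
    ← Finset.sum_add_distrib]
  refine Finset.sum_congr rfl fun β hβ => ?_
  rw [he β (Finset.ne_of_mem_erase hβ)]
  module

/-- For a singlet, the spins away from `α` act together as minus the spin at `α`. -/
theorem actsLocally_one (hN : Even N) (h2 : 2 ≤ N) (α : Fin N) : ActsLocally α fun _ => 1 := by
  refine ⟨(-1 : ℂ) • hsPoly N, (isLinearAt_hsPoly α).smul _, fun i => ?_⟩
  have h := sum_fockSpin_hsPoly hN h2 i
  rw [← Finset.add_sum_erase _ _ (Finset.mem_univ α)] at h
  simp only [one_smul]
  rw [eq_neg_of_add_eq_zero_right h, map_smul, neg_one_smul]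

theorem actsLocally_coeff (hN : Even N) (h2 : 2 ≤ N) (α : Fin N) : ActsLocally α (coeff α) :=
  exists_linear_fockSpin (isLinearAt_hsPoly α) (raiseTot_hsPoly hN h2) _
    (pderiv_sum_lower_hsPoly h2 α)

/-- On the unit circle, conjugation is inversion, so this weight is affine in `coeff` with
coefficients depending only on `α`. -/
theorem actsLocally_conjCoeff (hN : Even N) (h2 : 2 ≤ N) (α : Fin N) :
    ActsLocally α (conjCoeff α) :=
  (actsLocally_coeff hN h2 α).combination (actsLocally_one hN h2 α) (-eta α ^ 2) (eta α)
    fun β hβ => by rw [conjCoeff_eq hβ.symm, mul_one]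

theorem actsLocally_add_div_sub (hN : Even N) (h2 : 2 ≤ N) (α : Fin N) :
    ActsLocally α fun β => (eta α + eta β) / (eta α - eta β) :=
  (actsLocally_coeff hN h2 α).combination (actsLocally_one hN h2 α) (2 * eta α) (-1)
    fun β hβ => by
      have := eta_sub_ne_zero hβ.symm
      rw [coeff]
      field_simp
      ring

theorem fockSpin_pow_succ (α : Fin N) (i : Fin 3) (p : Fock N) (n : ℕ) :
    fockSpin α i (p ^ (n + 1)) = ((n + 1 : ℂ) • p ^ n) * fockSpin α i p := by
  induction n with
  | zero => simp
  | succ n ih =>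
    rw [pow_succ, fockSpin_mul, ih, pow_succ]
    push_cast
    simp only [MvPolynomial.smul_eq_C_mul, map_add, map_one]
    ring

theorem coe_vecSum_groundState {n : ℕ} {α : Fin N} {c : Fin N → ℂ} {g : Fock N}
    (hg : ∀ i, ∑ β ∈ Finset.univ.erase α, c β • fockSpin β i (hsPoly N) = fockSpin α i g)
    (i : Fin 3) :
    ((vecSum spin α c i (groundState N (n + 1)) : SpinSpace N (n + 1)) : Fock N)
      = hsPoly N ^ n * fockSpin α i ((n + 1 : ℂ) • g) := by
  rw [vecSum, LinearMap.sum_apply, Submodule.coe_sum, map_smul, ← hg, mul_smul_comm,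
    Finset.mul_sum, Finset.smul_sum]
  refine Finset.sum_congr rfl fun β _ => ?_
  rw [LinearMap.smul_apply, Submodule.coe_smul, coe_spin, groundState, fockSpin_pow_succ,
    mul_smul_comm, smul_mul_assoc, smul_comm]

/-- The common source of both annihilation results: `coe_vecSum_groundState` brings the vector to
the form treated by `top_component_pow_mul`. -/
theorem topProj_groundState (hk : 0 < k) {α : Fin N} {c : Fin N → ℂ} (hc : ActsLocally α c)
    (i : Fin 3) : topProj (qn k) (spin α) (vecSum spin α c) i (groundState N k) = 0 := by
  obtain ⟨n, rfl⟩ : ∃ n, k = n + 1 := ⟨k - 1, by omega⟩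
  obtain ⟨g, hg, hgc⟩ := hc
  refine Subtype.ext ?_
  have h := top_component_pow_mul (isLinearAt_hsPoly α) (hg.smul (n + 1 : ℂ)) n i
  simp only [← coe_vecSum_groundState hgc] at h
  refine Eq.trans ?_ h
  simp only [map_sum]
  simp [topProj, cross, dot, coe_spin]

theorem opD_groundState (hN : Even N) (h2 : 2 ≤ N) (hk : 0 < k) (α : Fin N) (i : Fin 3) :
    opD α i (groundState N k) = 0 := by
  have h : opD (k := k) α i = (1 / 2 : ℂ) • topProj (qn k) (spin α)
      (vecSum spin α fun β => (eta α + eta β) / (eta α - eta β)) i :=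
    chainD_eq_topProj (qn k) spin α i
  rw [h, LinearMap.smul_apply, topProj_groundState hk (actsLocally_add_div_sub hN h2 α),
    smul_zero]

theorem qn_add_ne_zero (k : ℕ) {m : ℕ} (hm : 0 < m) : qn k + m ≠ 0 := by
  rw [qn]
  have h : (k : ℂ) + 2 * m ≠ 0 := by exact_mod_cast (by omega : k + 2 * m ≠ 0)
  exact fun e => h (by linear_combination 2 * e)

theorem qn_add_one_ne_zero (k : ℕ) : qn k + 1 ≠ 0 := by
  exact_mod_cast qn_add_ne_zero k one_pos

theorem quad_smul_eq_zero {R M : Type*} [Ring R] [Algebra ℂ R] [AddCommGroup M] [Module R M]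
    {s : ℂ} {S U W V : Fin 3 → R} (h : IsSpinPair s S U W V) (hs : s + 1 ≠ 0) {x : M}
    (hU : ∀ i, topProj s S U i • x = 0) (hW : ∀ i, topProj s S W i • x = 0) (i : Fin 3) :
    IsSpinPair.quad s S U W V i • x = 0 := by
  rw [h.quad_eq_topProj hs]
  simp only [Algebra.smul_def, dot, cross, add_smul, sub_smul, mul_smul, Finset.sum_smul, hU, hW,
    smul_zero, Finset.sum_const_zero, sub_zero, add_zero]

theorem opA_groundState (hN : Even N) (h2 : 2 ≤ N) (hk : 0 < k) (α : Fin N) (i : Fin 3) :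
    opA α i (groundState N k) = 0 := by
  have h : opA (k := k) α i = IsSpinPair.quad (qn k) (spin α) (vecSum spin α (conjCoeff α))
      (vecSum spin α (coeff α)) (vecSum spin α (invDistSq α)) i :=
    chainA_eq_quad (qn k) spin α i
  rw [h]
  exact quad_smul_eq_zero (M := SpinSpace N k) (isSpinChain_spin.isSpinPair α)
    (qn_add_one_ne_zero k)
    (topProj_groundState hk (actsLocally_conjCoeff hN h2 α))
    (topProj_groundState hk (actsLocally_coeff hN h2 α)) i

theorem totalSpin_groundState (hN : Even N) (h2 : 2 ≤ N) (hk : 0 < k) (i : Fin 3) :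
    totalSpin i (groundState N k) = 0 := by
  obtain ⟨n, rfl⟩ : ∃ n, k = n + 1 := ⟨k - 1, by omega⟩
  refine Subtype.ext ?_
  rw [totalSpin, LinearMap.sum_apply, Submodule.coe_sum]
  simp only [coe_spin, groundState, fockSpin_pow_succ]
  rw [← Finset.mul_sum, sum_fockSpin_hsPoly hN h2, mul_zero]
  rfl

theorem sum_opD (i : Fin 3) : ∑ α : Fin N, opD (k := k) α i = opLambda i :=
  sum_chainD (qn k) spin i

theorem sum_opA (i : Fin 3) :
    ∑ α : Fin N, opA (k := k) α i
      = opUpsilon i + ((qn k + 1) ^ 3 * (((N : ℂ) ^ 2 - 1) / 6)) • totalSpin i :=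
  isSpinChain_spin.sum_chainA i

theorem opLambda_groundState (hN : Even N) (h2 : 2 ≤ N) (hk : 0 < k) (i : Fin 3) :
    opLambda i (groundState N k) = 0 := by
  rw [← sum_opD, LinearMap.sum_apply]
  exact Finset.sum_eq_zero fun α _ => opD_groundState hN h2 hk α i

theorem opUpsilon_groundState (hN : Even N) (h2 : 2 ≤ N) (hk : 0 < k) (i : Fin 3) :
    opUpsilon i (groundState N k) = 0 := by
  -- In the sum rule applied to the state, the `opA` terms and the total spin both vanish, which
  -- isolates Υ.
  have h := LinearMap.congr_fun (sum_opA (N := N) (k := k) i) (groundState N k)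
  rw [LinearMap.sum_apply, Finset.sum_eq_zero fun α _ => opA_groundState hN h2 hk α i,
    LinearMap.add_apply, LinearMap.smul_apply, totalSpin_groundState hN h2 hk, smul_zero,
    add_zero] at h
  exact h.symm

theorem sum_dot_opA (hk : 0 < k) :
    (1 / (2 * qn k * (qn k + 2) * (2 * qn k + 3))) •
        (∑ α : Fin N, dot (spin (k := k) α) (opA α))
      + ((qn k + 1) / (2 * (2 * qn k + 3))) • dot (totalSpin (N := N)) totalSpin
      = chainH (qn k) spin
        + (qn k * (qn k + 1) ^ 2 / (2 * qn k + 3) * ((N : ℂ) * ((N : ℂ) ^ 2 + 5) / 12)) •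
          (1 : Module.End ℂ (SpinSpace N k)) := by
  have h0 : qn k ≠ 0 := by
    rw [qn]
    exact div_ne_zero (by exact_mod_cast hk.ne') two_ne_zero
  have h2 : qn k + 2 ≠ 0 := by exact_mod_cast qn_add_ne_zero k two_pos
  have h3 : 2 * qn k + 3 ≠ 0 := by
    rw [qn]
    have h : (k : ℂ) + 3 ≠ 0 := by exact_mod_cast (by omega : k + 3 ≠ 0)
    exact fun e => h (by linear_combination e)
  exact isSpinChain_spin.sum_dot_chainA h0 (qn_add_one_ne_zero k) h2 h3

theorem smul_add_smul_one_eq {R : Type*} [Ring R] [Algebra ℂ R] (a b : ℂ) {x y : R}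
    (h : x = y + b • (1 : R)) : a • x = a • y - (-a * b) • (1 : R) := by
  rw [h]
  module

end

end SpinChain

end

theorem mainTheorem4 (N k : ℕ) (hN : Even N) (hN0 : 0 < N) (hk : 0 < k) :
    (∀ (α : Fin N) (i : Fin 3), SpinChain.opD α i (SpinChain.groundState N k) = 0) ∧
    (∀ (α : Fin N) (i : Fin 3), SpinChain.opA α i (SpinChain.groundState N k) = 0) ∧
    (∀ i : Fin 3,
      ∑ α : Fin N, SpinChain.opD (k := k) α i = SpinChain.opLambda (N := N) i) ∧
    (∀ i : Fin 3, SpinChain.opLambda i (SpinChain.groundState N k) = 0) ∧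
    (∀ i : Fin 3,
      ∑ α : Fin N, SpinChain.opA (k := k) α i
        = SpinChain.opUpsilon (N := N) i
          + ((SpinChain.qn k + 1) ^ 3 * (((N : ℂ) ^ 2 - 1) / 6)) •
            SpinChain.totalSpin (N := N) i) ∧
    (∀ i : Fin 3, SpinChain.opUpsilon i (SpinChain.groundState N k) = 0) ∧
    (2 * (Real.pi : ℂ) ^ 2 / (N : ℂ) ^ 2) •
        ((1 / (2 * SpinChain.qn k * (SpinChain.qn k + 2) * (2 * SpinChain.qn k + 3))) •
          (∑ α : Fin N, SpinChain.dot (SpinChain.spin (k := k) α) (SpinChain.opA α))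
        + ((SpinChain.qn k + 1) / (2 * (2 * SpinChain.qn k + 3))) •
          SpinChain.dot (SpinChain.totalSpin (N := N)) SpinChain.totalSpin)
      = SpinChain.hamiltonian N k
        - SpinChain.groundEnergy N k • (1 : Module.End ℂ (SpinChain.SpinSpace N k)) := by
  have h2 : 2 ≤ N := by
    obtain ⟨m, rfl⟩ := hN
    omega
  refine ⟨SpinChain.opD_groundState hN h2 hk, SpinChain.opA_groundState hN h2 hk,
    SpinChain.sum_opD, SpinChain.opLambda_groundState hN h2 hk, SpinChain.sum_opA,
    SpinChain.opUpsilon_groundState hN h2 hk, ?_⟩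
  have e : SpinChain.groundEnergy N k = -(2 * (Real.pi : ℂ) ^ 2 / (N : ℂ) ^ 2)
      * (SpinChain.qn k * (SpinChain.qn k + 1) ^ 2 / (2 * SpinChain.qn k + 3)
        * ((N : ℂ) * ((N : ℂ) ^ 2 + 5) / 12)) := by
    rw [SpinChain.groundEnergy, mul_assoc]
  rw [e]
  exact SpinChain.smul_add_smul_one_eq (R := Module.End ℂ (SpinChain.SpinSpace N k)) _ _
    (SpinChain.sum_dot_opA hk)
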